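/- \textbf{Model.} Time is slotted. A master node sends data packets and energy to a slave node, which sends data packets back. The parameters are $\lambda,\eta,P_t,T_B,N_0,\ell>0$ and $p\in[0,1]$; put $\theta=\lambda N_0\ell/(P_tT_B)$. All power gains are independent and exponentially distributed with rate $\lambda$. A block with gain $\gamma$ carries $\gamma P_tT_B/N_0$ nats of information, or, if it is used for energy transfer, supplies the energy $\eta\gamma P_tT_B$ to the slave node. A packet has $\ell$ nats; its number $S$ of transmission blocks is the first $j$ for which $j$ blocks together carry at least $\ell$ nats. In each block the master node generates a packet with probability $p$, independently of everything else. The slave node follows the best-effort policy: a new uplink packet is generated at the moment the previous one is completed. Each transmission block of an uplink packet takes $\max\{1,\tau_H\}$ downlink idle blocks, where $\tau_H$ is the least $j\ge 0$ such that the remaining energy plus the energy harvested in $j$ idle blocks is at least $P_tT_B$; the remaining energy is (by memorylessness) distributed as the energy of one block, and it is taken independent for different transmission blocks. The uplink service time of a packet is $S_{UL}=\sum_{i=1}^{S}\max\{1,\tau_{H,i}\}$, and its system time is $$T=S_{UL}+\sum_{i=1}^{S_{UL}}\sum_{j=1}^{F_i}B_{ij}.$$ Here $F_i$ is the number of uninterrupted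 downlink busy periods before the $i$-th of these idle blocks (after each busy period another one follows immediately with probability $p$, and one precedes the idle block in the first place with probability $p$, so $\Pr\{F_i=j\}=p^j(1-p)$), and the $B_{ij}$ are independent busy periods of the downlink queue (service times distributed as $S$; one arrival with probability $p$ in each block of the busy period, the last one included). If $U(n)$ is the generation time of the latest uplink packet received before block $n$, the uplink age of information in block $n$ is $\Delta(n)=n-U(n)$ (with an arbitrary finite initial age), the average uplink AoI is $\bar\Delta=\lim_{N\to\infty}\frac1N\sum_{n=1}^N\Delta(n)$, and the uplink data rate is $q=\lim_{N\to\infty}K(N)/N$, where $K(N)$ is the number of uplink packets delivered in the first $N$ blocks. \textbf{Claim.} As $(\theta+1)p\to 0$, both limits eventually exist almost surely and are deterministic, and, for fixed $\lambda/\eta$ and $\theta$, $$\bar\Delta\to\Delta^*:=\frac12\left(\frac{\frac{\lambda^2}{\eta^2}+\frac\lambda\eta+e^{-\lambda/\eta}}{\frac\lambda\eta+e^{-\lambda/\eta}}+\frac{\big(\frac\lambda\eta+e^{-\lambda/\eta}\big)(3\theta^2+6\theta+2)}{1+\theta}\right)+\frac12,\qquad q\to q^*:=\frac{1}{\big(\frac\lambda\eta+e^{-\lambda/\eta}\big)(1+\theta)}.$$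 If $\lambda/\eta$ and $\theta$ vary along with $p$ while $(\theta+1)p\to0$, then $\bar\Delta/\Delta^*\to1$ and $q/q^*\to1$. -/

import Mathlib

open MeasureTheory ProbabilityTheory Filter Topology

noncomputable section

/-- Parameters of the two-way data exchanging system. -/
structure System where
  /-- rate of the exponentially distributed channel power gain -/
  lam : ℝ
  /-- efficiency of the wireless energy transfer -/
  eta : ℝ
  /-- transmit power -/
  Pt : ℝ
  /-- block length -/
  TB : ℝ
  /-- noise spectrum density -/
  N0 : ℝ
  /-- packet length in nats -/
  ell : ℝ
  /-- downlink data rate: probability that the master node generates a packet in a block -/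
  p : unitInterval
  lam_pos : 0 < lam
  eta_pos : 0 < eta
  Pt_pos : 0 < Pt
  TB_pos : 0 < TB
  N0_pos : 0 < N0
  ell_pos : 0 < ell

/-- Labels of the power gains (one per block). Packets, blocks and so on are counted from `0`. -/
inductive GainIdx where
  /-- uplink gain in the `i`-th block in which uplink packet `k` is being transmitted -/
  | uplink (k i : ℕ)
  /-- gains for the energy used in the `i`-th transmission block of uplink packet `k`:
  the label `j = 0` gives the remaining energy (by memorylessness it is distributed as the energy
  of one block), the label `j + 1` gives the `j`-th downlink idle block used for harvesting -/
  | harvest (k i j : ℕ)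
  /-- downlink gain in the `n`-th transmission block of the `m`-th downlink packet of the `j`-th
  downlink busy period occurring just before the `i`-th block of the uplink service time of uplink
  packet `k` -/
  | downlink (k i j m n : ℕ)

/-- Labels of the packet generations at the master node. -/
inductive ArrivalIdx where
  /-- before the `i`-th block of the uplink service time of packet `k`, after `j` uninterrupted
  downlink busy periods: is a downlink packet generated, so that another busy period follows? -/
  | start (k i j : ℕ)
  /-- is a downlink packet generated in the `n`-th block of that busy period? -/
  | during (k i j n : ℕ)

/-- The sample space: all power gains and all downlink packet generations. -/
abbrev Sample : Type := (GainIdx → ℝ) × (ArrivalIdx → Bool)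

/-- First `j` such that `x 0 + ... + x (j - 1)` is at least `c`. -/
def hittingTime (x : ℕ → ℝ) (c : ℝ) : ℕ :=
  sInf {j : ℕ | c ≤ ∑ i ∈ Finset.range j, x i}

/-- Length of a busy period of a work-conserving single-server queue: it starts with one packet,
the `m`-th packet needs `S m` blocks, and `A n` tells whether a further packet arrives in its `n`-th
block. It ends with the first block `n` after which all packets that have arrived are served. -/
def busyPeriod (S : ℕ → ℕ) (A : ℕ → Bool) : ℕ :=
  sInf {n : ℕ | ∑ m ∈ Finset.range (1 + ((Finset.range n).filter (fun t => A t = true)).card), S m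
    ≤ n}

namespace System

variable (s : System)

/-- `θ = λ N₀ ℓ / (P_t T_B)`. -/
def theta : ℝ := s.lam * s.N0 * s.ell / (s.Pt * s.TB)

/-- The ratio `λ / η`. -/
def ratio : ℝ := s.lam / s.eta

/-- All power gains are independent and exponential with rate `λ`, all packet generations are
independent with probability `p`, and the two families are independent. -/
def law : Measure Sample :=
  haveI := isProbabilityMeasure_expMeasure s.lam_pos
  (Measure.infinitePi (fun _ : GainIdx => expMeasure s.lam)).prod
    (Measure.infinitePi (fun _ : ArrivalIdx => bernoulliMeasure true false s.p))

/-- Information (in nats) carried by a block with power gain `g` (low SNR). -/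
def info (g : ℝ) : ℝ := g * s.Pt * s.TB / s.N0

/-- Energy received by the slave node in a block with power gain `g`. -/
def energy (g : ℝ) : ℝ := s.eta * g * s.Pt * s.TB

/-- Service time of a packet: number of transmission blocks needed to deliver `ℓ` nats. -/
def service (g : ℕ → ℝ) : ℕ := hittingTime (fun i => s.info (g i)) s.ell

/-- Number `S` of transmission blocks of uplink packet `k`. -/
def upService (ω : Sample) (k : ℕ) : ℕ := s.service (fun i => ω.1 (.uplink k i))

/-- `τ_H`: number of idle blocks of harvesting before the energy, starting from the remaining
energy, is at least `P_t T_B`. -/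
def harvestTime (ω : Sample) (k i : ℕ) : ℕ :=
  sInf {j : ℕ | s.Pt * s.TB ≤ s.energy (ω.1 (.harvest k i 0)) +
    ∑ l ∈ Finset.range j, s.energy (ω.1 (.harvest k i (l + 1)))}

/-- Uplink service time `S_UL`. -/
def upServiceTime (ω : Sample) (k : ℕ) : ℕ :=
  ∑ i ∈ Finset.range (s.upService ω k), max 1 (s.harvestTime ω k i)

/-- Number `F` of uninterrupted downlink busy periods just before the `i`-th block of the uplink
service time of packet `k`. -/
def numBusy (ω : Sample) (k i : ℕ) : ℕ :=
  sInf {j : ℕ | ω.2 (.start k i j) = false}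

/-- Length `B_D` of the `j`-th of these downlink busy periods. -/
def downBusy (ω : Sample) (k i j : ℕ) : ℕ :=
  busyPeriod (fun m => s.service (fun n => ω.1 (.downlink k i j m n)))
    (fun n => ω.2 (.during k i j n))

/-- Uplink system time `T` of packet `k`. -/
def systemTime (ω : Sample) (k : ℕ) : ℕ :=
  s.upServiceTime ω k +
    ∑ i ∈ Finset.range (s.upServiceTime ω k), ∑ j ∈ Finset.range (numBusy ω k i), s.downBusy ω k i j

/-- Generation epoch of uplink packet `k`: each packet is generated immediately after the completion
of the previous one. -/
def genEpoch (ω : Sample) (k : ℕ) : ℕ := ∑ i ∈ Finset.range k, s.systemTime ω i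

/-- Departure epoch of uplink packet `k`. -/
def depEpoch (ω : Sample) (k : ℕ) : ℕ := s.genEpoch ω k + s.systemTime ω k

/-- Number of uplink packets completely transmitted in the blocks `1, ..., N`. -/
def delivered (ω : Sample) (N : ℕ) : ℕ := {k : ℕ | s.depEpoch ω k ≤ N}.ncard

/-- Generation time `U(n)` of the latest packet the master node has received when block `n` starts
(the age is reset at the end of departure blocks); `Δ₀` is the initial age. -/
def latestGen (ω : Sample) (Δ₀ n : ℕ) : ℝ :=
  match {k : ℕ | s.depEpoch ω k < n}.ncard with
  | 0 => -(Δ₀ : ℝ)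
  | k + 1 => (s.genEpoch ω k : ℝ)

/-- Uplink age of information in block `n`. -/
def age (ω : Sample) (Δ₀ n : ℕ) : ℝ := (n : ℝ) - s.latestGen ω Δ₀ n

/-- The time-average uplink age of information exists almost surely, for every initial age, and
equals `v`. -/
def HasAverageAoI (v : ℝ) : Prop :=
  ∀ Δ₀ : ℕ, ∀ᵐ ω ∂s.law,
    Tendsto (fun N : ℕ => (1 / (N : ℝ)) * ∑ n ∈ Finset.Icc 1 N, s.age ω Δ₀ n) atTop (𝓝 v)

/-- The uplink data rate (packets per block) exists almost surely and equals `v`. -/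
def HasUplinkRate (v : ℝ) : Prop :=
  ∀ᵐ ω ∂s.law, Tendsto (fun N : ℕ => (s.delivered ω N : ℝ) / (N : ℝ)) atTop (𝓝 v)

end System

/-- Light-downlink average uplink age of information, for `a = λ / η`. -/
def lightAoI (a θ : ℝ) : ℝ :=
  1 / 2 * ((a ^ 2 + a + Real.exp (-a)) / (a + Real.exp (-a)) +
    (a + Real.exp (-a)) * (3 * θ ^ 2 + 6 * θ + 2) / (1 + θ)) + 1 / 2

/-- Light-downlink uplink data rate, for `a = λ / η`. -/
def lightRate (a θ : ℝ) : ℝ := 1 / ((a + Real.exp (-a)) * (1 + θ))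

end

/-! The system times `T k` of the uplink packets are independent and identically distributed, and
each packet is generated when its predecessor departs, so departures form a renewal process. The
strong law and the elementary renewal theorem give the rate 1/E T. Between the departures of packets
k and k+1 the age runs through T_k + 1, ..., T_k + T_{k+1}, with sum T_k T_{k+1} + T_{k+1}(T_{k+1} +
1)/2 (`cycleAge`). These sums are one-dependent and obey a strong law (`strong_law_one_dependent`),
so the average age is E T + E T²/(2 E T) + 1/2 (`System.hasAverageAoI`). Only two moments of T
matter.

With no downlink traffic T would be S_UL. A sum of exponential gains crosses a level after 1 +
Poisson blocks (`expSeq_map_hittingTime`), so S is 1 + Poisson(θ) and τ_H is Poisson(λ/η), and the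
moments of the random sum S_UL are explicit (`System.meanUp`, `System.sqUp`). The claimed constants
are the renewal formulas evaluated at these moments (`System.lightAoI_eq`, `System.lightRate_eq`).

It remains to see that the downlink changes both moments by a factor 1 + O(load), where load =
(θ+1)p. From below, T ≥ S_UL. From above, T is a sum of S_UL terms 1 + delay, independent of S_UL. A
Chernoff bound (`System.downBusy_tail`) shows that a busy period has moments of order θ+1 and
(θ+1)², while the number of busy periods before a block has both moments O(p). Hence the delay has
mean O(load) and second moment O(load·(θ+1)); the surplus factor θ+1 is absorbed by
`System.meanUp_mul_le_sqUp`. All constants are absolute, so the estimates are uniform in λ/η and θ.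
This gives the relative-error statement, and the case of fixed parameters follows from it. -/

noncomputable section

open scoped ENNReal NNReal Nat

/-! ### Measurability and moments of sums with a random number of terms. -/

section RandomSums

variable {Ω : Type*}

/-- The random times of the model are infima of this form. The value 0 needs an extra piece of the
preimage: since `sInf ∅ = 0`, it also collects the outcomes for which no index qualifies. -/
lemma measurable_sInf_nat {m : MeasurableSpace Ω} {P : ℕ → Ω → Prop}
    (h : ∀ j, MeasurableSet {ω | P j ω}) : Measurable fun ω => sInf {j : ℕ | P j ω} := by
  refine measurable_to_countable' fun n => ?_
  have key : (fun ω => sInf {j : ℕ | P j ω}) ⁻¹' {n} =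
      ({ω | P n ω} ∩ ⋂ j ∈ Finset.range n, {ω | P j ω}ᶜ) ∪ ({_ω | n = 0} ∩ ⋂ j, {ω | P j ω}ᶜ) := by
    ext ω
    simp only [Set.mem_preimage, Set.mem_singleton_iff, Set.mem_union, Set.mem_inter_iff,
      Set.mem_ofPred_eq, Set.mem_iInter, Set.mem_compl_iff, Finset.mem_range]
    constructor
    · rintro rfl
      rcases Set.eq_empty_or_nonempty {j | P j ω} with he | hne
      · right
        refine ⟨by simp [he], fun j hj => ?_⟩
        have : j ∈ {j | P j ω} := hj
        simp [he] at this
      · exact Or.inl ⟨Nat.sInf_mem hne, fun j hj => Nat.notMem_of_lt_sInf hj⟩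
    · rintro (⟨h1, h2⟩ | ⟨rfl, h2⟩)
      · exact le_antisymm (Nat.sInf_le h1) (le_csInf ⟨n, h1⟩ fun j hj => by
          by_contra hlt
          exact h2 j (not_le.1 hlt) hj)
      · have : {j | P j ω} = ∅ := Set.eq_empty_of_forall_notMem h2
        simp [this]
  rw [key]
  exact ((h n).inter (Finset.measurableSet_biInter _ fun j _ => (h j).compl)).union
    ((MeasurableSet.const _).inter (MeasurableSet.iInter fun j => (h j).compl))

lemma measurable_apply_nat {m : MeasurableSpace Ω} {β : Type*} [MeasurableSpace β]
    {N : Ω → ℕ} {g : ℕ → Ω → β} (hN : Measurable N) (hg : ∀ n, Measurable (g n)) :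
    Measurable fun ω => g (N ω) ω :=
  (measurable_from_prod_countable_right (f := fun q : ℕ × Ω => g q.1 q.2) hg).comp
    (hN.prodMk measurable_id)

lemma measurable_sum_range_random {m : MeasurableSpace Ω} {β : Type*} [MeasurableSpace β]
    [AddCommMonoid β] [MeasurableAdd₂ β]
    {N : Ω → ℕ} {Z : ℕ → Ω → β} (hN : Measurable N) (hZ : ∀ n, Measurable (Z n)) :
    Measurable fun ω => ∑ i ∈ Finset.range (N ω), Z i ω :=
  measurable_apply_nat (g := fun n ω => ∑ i ∈ Finset.range n, Z i ω) hN fun _ =>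
    Finset.measurable_fun_sum _ fun i _ => hZ i

lemma tsum_indicator_mul_apply (N : ℕ) (g : ℕ → ℝ≥0∞) :
    ∑' n, (if N = n then 1 else 0) * g n = g N := by
  rw [tsum_eq_single N fun n hn => by simp [Ne.symm hn]]
  simp

/-- A random index independent of a sequence of functions may be frozen under the integral. -/
lemma lintegral_apply_of_indep {m₁ m₂ mΩ : MeasurableSpace Ω} {μ : Measure Ω} (h₁ : m₁ ≤ mΩ)
    (h₂ : m₂ ≤ mΩ) (hind : Indep m₁ m₂ μ) {N : Ω → ℕ} {g : ℕ → Ω → ℝ≥0∞} (hN : Measurable[m₁] N)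
    (hg : ∀ n, Measurable[m₂] (g n)) :
    ∫⁻ ω, g (N ω) ω ∂μ = ∫⁻ ω, ∫⁻ ω', g (N ω) ω' ∂μ ∂μ := by
  have hI : ∀ n, Measurable[m₁] fun ω => (if N ω = n then 1 else 0 : ℝ≥0∞) := fun n =>
    Measurable.ite (hN (measurableSet_singleton n)) measurable_const measurable_const
  have hI' : ∀ n, Measurable fun ω => (if N ω = n then 1 else 0 : ℝ≥0∞) := fun n =>
    (hI n).mono h₁ le_rfl
  have hprod : ∀ n, Measurable fun ω => (if N ω = n then 1 else 0 : ℝ≥0∞) * g n ω := fun n =>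
    (hI' n).mul ((hg n).mono h₂ le_rfl)
  -- Splitting over the values of `N` leaves products of an indicator and `g n`, whose factors are
  -- independent.
  calc ∫⁻ ω, g (N ω) ω ∂μ
      = ∫⁻ ω, ∑' n, (if N ω = n then 1 else 0) * g n ω ∂μ := by
        simp_rw [fun ω => tsum_indicator_mul_apply (N ω) fun n => g n ω]
    _ = ∑' n, (∫⁻ ω, (if N ω = n then 1 else 0) ∂μ) * ∫⁻ ω', g n ω' ∂μ := by
        rw [lintegral_tsum fun n => (hprod n).aemeasurable]
        exact tsum_congr fun n =>
          lintegral_mul_eq_lintegral_mul_lintegral_of_independent_measurableSpace h₁ h₂ hind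
            (hI n) (hg n)
    _ = ∫⁻ ω, ∑' n, (if N ω = n then 1 else 0) * ∫⁻ ω', g n ω' ∂μ ∂μ := by
        rw [lintegral_tsum fun n => ((hI' n).mul_const _).aemeasurable]
        exact tsum_congr fun n => (lintegral_mul_const _ (hI' n)).symm
    _ = _ := by
        simp_rw [fun ω => tsum_indicator_mul_apply (N ω) fun n => ∫⁻ ω', g n ω' ∂μ]

lemma lintegral_sum_range_mul {mΩ : MeasurableSpace Ω} {μ : Measure Ω}
    {Z : ℕ → Ω → ℝ≥0∞} (hZ : ∀ i, Measurable (Z i))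
    (hind : ∀ i j, i < j → IndepFun (Z i) (Z j) μ) (n : ℕ) :
    ∫⁻ ω, (∑ i ∈ Finset.range n, Z i ω) * Z n ω ∂μ =
      (∑ i ∈ Finset.range n, ∫⁻ ω, Z i ω ∂μ) * ∫⁻ ω, Z n ω ∂μ := by
  simp_rw [Finset.sum_mul]
  rw [lintegral_finsetSum _ fun i _ => by exact (hZ i).mul (hZ n)]
  exact Finset.sum_congr rfl fun i hi =>
    lintegral_mul_eq_lintegral_mul_lintegral_of_indepFun (hZ i) (hZ n)
      (hind i n (Finset.mem_range.1 hi))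

lemma lintegral_sum_range_succ_sq {mΩ : MeasurableSpace Ω} {μ : Measure Ω}
    {Z : ℕ → Ω → ℝ≥0∞} (hZ : ∀ i, Measurable (Z i))
    (hind : ∀ i j, i < j → IndepFun (Z i) (Z j) μ) (n : ℕ) :
    ∫⁻ ω, (∑ i ∈ Finset.range (n + 1), Z i ω) ^ 2 ∂μ =
      ∫⁻ ω, (∑ i ∈ Finset.range n, Z i ω) ^ 2 ∂μ +
        2 * ((∑ i ∈ Finset.range n, ∫⁻ ω, Z i ω ∂μ) * ∫⁻ ω, Z n ω ∂μ) + ∫⁻ ω, Z n ω ^ 2 ∂μ := by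
  have hS : Measurable fun ω => ∑ i ∈ Finset.range n, Z i ω :=
    Finset.measurable_fun_sum _ fun i _ => hZ i
  have hP : Measurable fun ω => (∑ i ∈ Finset.range n, Z i ω) * Z n ω := hS.mul (hZ n)
  rw [← lintegral_sum_range_mul hZ hind, ← lintegral_const_mul _ hP,
    ← lintegral_add_left (hS.pow_const 2),
    ← lintegral_add_left (by exact (hS.pow_const 2).add (hP.const_mul 2))]
  refine lintegral_congr fun ω => ?_
  rw [Finset.sum_range_succ]
  ring

/-- Expanding the square gives n diagonal terms and n(n-1) products of means. The negative part of
n(n-1)a² is kept on the left, here and in the variants below, so that no truncated subtraction in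
`ℝ≥0∞` occurs. -/
lemma lintegral_sum_range_sq_le {mΩ : MeasurableSpace Ω} {μ : Measure Ω}
    {Z : ℕ → Ω → ℝ≥0∞} (hZ : ∀ i, Measurable (Z i))
    (hind : ∀ i j, i < j → IndepFun (Z i) (Z j) μ) {a v : ℝ≥0∞}
    (ha : ∀ i, ∫⁻ ω, Z i ω ∂μ ≤ a) (hv : ∀ i, ∫⁻ ω, Z i ω ^ 2 ∂μ ≤ v) (n : ℕ) :
    ∫⁻ ω, (∑ i ∈ Finset.range n, Z i ω) ^ 2 ∂μ + n * a ^ 2 ≤ n * v + (n : ℝ≥0∞) ^ 2 * a ^ 2 := by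
  induction n with
  | zero => simp
  | succ n ih =>
    have hsum : ∑ i ∈ Finset.range n, ∫⁻ ω, Z i ω ∂μ ≤ n * a := by
      simpa using Finset.sum_le_card_nsmul (Finset.range n) _ a fun i _ => ha i
    rw [lintegral_sum_range_succ_sq hZ hind]
    push_cast
    calc _ ≤ ∫⁻ ω, (∑ i ∈ Finset.range n, Z i ω) ^ 2 ∂μ + 2 * ((n * a) * a) + v
          + (n + 1) * a ^ 2 := by gcongr <;> apply_assumption
      _ = (∫⁻ ω, (∑ i ∈ Finset.range n, Z i ω) ^ 2 ∂μ + n * a ^ 2) +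
          (2 * ((n * a) * a) + v + a ^ 2) := by ring
      _ ≤ (n * v + (n : ℝ≥0∞) ^ 2 * a ^ 2) + (2 * ((n * a) * a) + v + a ^ 2) := by gcongr
      _ = _ := by ring

lemma lintegral_sum_range_sq_eq {mΩ : MeasurableSpace Ω} {μ : Measure Ω}
    {Z : ℕ → Ω → ℝ≥0∞} (hZ : ∀ i, Measurable (Z i))
    (hind : ∀ i j, i < j → IndepFun (Z i) (Z j) μ) {a v : ℝ≥0∞}
    (ha : ∀ i, ∫⁻ ω, Z i ω ∂μ = a) (hv : ∀ i, ∫⁻ ω, Z i ω ^ 2 ∂μ = v) (n : ℕ) :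
    ∫⁻ ω, (∑ i ∈ Finset.range n, Z i ω) ^ 2 ∂μ + n * a ^ 2 = n * v + (n : ℝ≥0∞) ^ 2 * a ^ 2 := by
  induction n with
  | zero => simp
  | succ n ih =>
    rw [lintegral_sum_range_succ_sq hZ hind]
    simp only [ha, hv, Finset.sum_const, Finset.card_range, nsmul_eq_mul]
    push_cast
    calc _ = (∫⁻ ω, (∑ i ∈ Finset.range n, Z i ω) ^ 2 ∂μ + n * a ^ 2) +
          (2 * ((n * a) * a) + v + a ^ 2) := by ring
      _ = _ := by rw [ih]; ring

lemma lintegral_random_sum_le {m₁ m₂ mΩ : MeasurableSpace Ω} {μ : Measure Ω} (h₁ : m₁ ≤ mΩ)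
    (h₂ : m₂ ≤ mΩ) (hind : Indep m₁ m₂ μ) {N : Ω → ℕ} {Z : ℕ → Ω → ℝ≥0∞} (hN : Measurable[m₁] N)
    (hZ : ∀ n, Measurable[m₂] (Z n)) {a : ℝ≥0∞} (ha : ∀ i, ∫⁻ ω, Z i ω ∂μ ≤ a) :
    ∫⁻ ω, ∑ i ∈ Finset.range (N ω), Z i ω ∂μ ≤ (∫⁻ ω, N ω ∂μ) * a := by
  have hN1 : Measurable fun ω => (N ω : ℝ≥0∞) := measurable_from_top.comp (hN.mono h₁ le_rfl)
  rw [lintegral_apply_of_indep h₁ h₂ hind (g := fun n ω => ∑ i ∈ Finset.range n, Z i ω) hN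
    fun n => Finset.measurable_fun_sum _ fun i _ => hZ i,
    ← lintegral_mul_const _ hN1]
  refine lintegral_mono fun ω => ?_
  rw [lintegral_finsetSum _ fun i _ => (hZ i).mono h₂ le_rfl]
  simpa using Finset.sum_le_card_nsmul (Finset.range (N ω)) _ a fun i _ => ha i

lemma lintegral_random_sum {m₁ m₂ mΩ : MeasurableSpace Ω} {μ : Measure Ω} (h₁ : m₁ ≤ mΩ)
    (h₂ : m₂ ≤ mΩ) (hind : Indep m₁ m₂ μ) {N : Ω → ℕ} {Z : ℕ → Ω → ℝ≥0∞} (hN : Measurable[m₁] N)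
    (hZ : ∀ n, Measurable[m₂] (Z n)) {a : ℝ≥0∞} (ha : ∀ i, ∫⁻ ω, Z i ω ∂μ = a) :
    ∫⁻ ω, ∑ i ∈ Finset.range (N ω), Z i ω ∂μ = (∫⁻ ω, N ω ∂μ) * a := by
  have hN1 : Measurable fun ω => (N ω : ℝ≥0∞) := measurable_from_top.comp (hN.mono h₁ le_rfl)
  rw [lintegral_apply_of_indep h₁ h₂ hind (g := fun n ω => ∑ i ∈ Finset.range n, Z i ω) hN
    fun n => Finset.measurable_fun_sum _ fun i _ => hZ i,
    ← lintegral_mul_const _ hN1]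
  refine lintegral_congr fun ω => ?_
  rw [lintegral_finsetSum _ fun i _ => (hZ i).mono h₂ le_rfl]
  simp [ha]

lemma lintegral_random_sum_sq_le {m₁ m₂ mΩ : MeasurableSpace Ω} {μ : Measure Ω} (h₁ : m₁ ≤ mΩ)
    (h₂ : m₂ ≤ mΩ) (hind : Indep m₁ m₂ μ) {N : Ω → ℕ} {Z : ℕ → Ω → ℝ≥0∞} (hN : Measurable[m₁] N)
    (hZ : ∀ n, Measurable[m₂] (Z n)) (hindZ : ∀ i j, i < j → IndepFun (Z i) (Z j) μ)
    {a v : ℝ≥0∞} (ha : ∀ i, ∫⁻ ω, Z i ω ∂μ ≤ a) (hv : ∀ i, ∫⁻ ω, Z i ω ^ 2 ∂μ ≤ v) :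
    ∫⁻ ω, (∑ i ∈ Finset.range (N ω), Z i ω) ^ 2 ∂μ + (∫⁻ ω, N ω ∂μ) * a ^ 2 ≤
      (∫⁻ ω, N ω ∂μ) * v + (∫⁻ ω, (N ω : ℝ≥0∞) ^ 2 ∂μ) * a ^ 2 := by
  have hN1 : Measurable fun ω => (N ω : ℝ≥0∞) := measurable_from_top.comp (hN.mono h₁ le_rfl)
  rw [lintegral_apply_of_indep h₁ h₂ hind
    (g := fun n ω => (∑ i ∈ Finset.range n, Z i ω) ^ 2) hN
    fun n => (Finset.measurable_fun_sum _ fun i _ => hZ i).pow_const 2,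
    ← lintegral_mul_const _ hN1, ← lintegral_mul_const _ hN1,
    ← lintegral_mul_const _ (hN1.pow_const 2), ← lintegral_add_right _ (hN1.mul_const _),
    ← lintegral_add_right _ ((hN1.pow_const 2).mul_const _)]
  exact lintegral_mono fun ω =>
    lintegral_sum_range_sq_le (fun i => (hZ i).mono h₂ le_rfl) hindZ ha hv (N ω)

lemma lintegral_random_sum_sq {m₁ m₂ mΩ : MeasurableSpace Ω} {μ : Measure Ω} (h₁ : m₁ ≤ mΩ)
    (h₂ : m₂ ≤ mΩ) (hind : Indep m₁ m₂ μ) {N : Ω → ℕ} {Z : ℕ → Ω → ℝ≥0∞} (hN : Measurable[m₁] N)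
    (hZ : ∀ n, Measurable[m₂] (Z n)) (hindZ : ∀ i j, i < j → IndepFun (Z i) (Z j) μ)
    {a v : ℝ≥0∞} (ha : ∀ i, ∫⁻ ω, Z i ω ∂μ = a) (hv : ∀ i, ∫⁻ ω, Z i ω ^ 2 ∂μ = v) :
    ∫⁻ ω, (∑ i ∈ Finset.range (N ω), Z i ω) ^ 2 ∂μ + (∫⁻ ω, N ω ∂μ) * a ^ 2 =
      (∫⁻ ω, N ω ∂μ) * v + (∫⁻ ω, (N ω : ℝ≥0∞) ^ 2 ∂μ) * a ^ 2 := by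
  have hN1 : Measurable fun ω => (N ω : ℝ≥0∞) := measurable_from_top.comp (hN.mono h₁ le_rfl)
  rw [lintegral_apply_of_indep h₁ h₂ hind
    (g := fun n ω => (∑ i ∈ Finset.range n, Z i ω) ^ 2) hN
    fun n => (Finset.measurable_fun_sum _ fun i _ => hZ i).pow_const 2,
    ← lintegral_mul_const _ hN1, ← lintegral_mul_const _ hN1,
    ← lintegral_mul_const _ (hN1.pow_const 2), ← lintegral_add_right _ (hN1.mul_const _),
    ← lintegral_add_right _ ((hN1.pow_const 2).mul_const _)]
  exact lintegral_congr fun ω =>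
    lintegral_sum_range_sq_eq (fun i => (hZ i).mono h₂ le_rfl) hindZ ha hv (N ω)

lemma ENNReal.sum_sq_le_card_mul (f : ℕ → ℝ≥0∞) (n : ℕ) :
    (∑ i ∈ Finset.range n, f i) ^ 2 ≤ n * ∑ i ∈ Finset.range n, f i ^ 2 := by
  have h := ENNReal.rpow_sum_le_const_mul_sum_rpow (Finset.range n) f (p := 2) one_le_two
  norm_num at h
  exact h

/-- Second moment of a random sum without independence of the summands. -/
lemma lintegral_random_sum_sq_le_mul {m₁ m₂ mΩ : MeasurableSpace Ω} {μ : Measure Ω} (h₁ : m₁ ≤ mΩ)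
    (h₂ : m₂ ≤ mΩ) (hind : Indep m₁ m₂ μ) {N : Ω → ℕ} {Z : ℕ → Ω → ℝ≥0∞} (hN : Measurable[m₁] N)
    (hZ : ∀ n, Measurable[m₂] (Z n)) {v : ℝ≥0∞} (hv : ∀ i, ∫⁻ ω, Z i ω ^ 2 ∂μ ≤ v) :
    ∫⁻ ω, (∑ i ∈ Finset.range (N ω), Z i ω) ^ 2 ∂μ ≤ (∫⁻ ω, (N ω : ℝ≥0∞) ^ 2 ∂μ) * v := by
  have hN1 : Measurable fun ω => (N ω : ℝ≥0∞) := measurable_from_top.comp (hN.mono h₁ le_rfl)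
  rw [lintegral_apply_of_indep h₁ h₂ hind
    (g := fun n ω => (∑ i ∈ Finset.range n, Z i ω) ^ 2) hN
    fun n => (Finset.measurable_fun_sum _ fun i _ => hZ i).pow_const 2,
    ← lintegral_mul_const _ (hN1.pow_const 2)]
  refine lintegral_mono fun ω => ?_
  calc ∫⁻ ω', (∑ i ∈ Finset.range (N ω), Z i ω') ^ 2 ∂μ
      ≤ ∫⁻ ω', N ω * ∑ i ∈ Finset.range (N ω), Z i ω' ^ 2 ∂μ :=
        lintegral_mono fun ω' => ENNReal.sum_sq_le_card_mul _ _
    _ = N ω * ∑ i ∈ Finset.range (N ω), ∫⁻ ω', Z i ω' ^ 2 ∂μ := by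
        rw [lintegral_const_mul _ (Finset.measurable_fun_sum _ fun i _ =>
          ((hZ i).mono h₂ le_rfl).pow_const 2),
          lintegral_finsetSum _ fun i _ => ((hZ i).mono h₂ le_rfl).pow_const 2]
    _ ≤ N ω * (N ω * v) := by
        gcongr
        simpa using Finset.sum_le_card_nsmul (Finset.range (N ω)) _ v fun i _ => hv i
    _ = (N ω : ℝ≥0∞) ^ 2 * v := by ring

end RandomSums

/-! ### Second moments from geometric tails. -/

section Tails

variable {Ω : Type*} {mΩ : MeasurableSpace Ω} {μ : Measure Ω}

/-- A square is a sum of consecutive odd numbers; integrating this turns tail probabilities into a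
second moment. -/
lemma natCast_sq_eq_tsum (N : ℕ) :
    (N : ℝ≥0∞) ^ 2 = ∑' n : ℕ, (if n < N then 1 else 0) * (2 * n + 1 : ℝ≥0∞) := by
  rw [tsum_eq_sum (s := Finset.range N) fun n hn => by simp_all]
  rw [Finset.sum_congr rfl fun n hn => by rw [if_pos (Finset.mem_range.1 hn), one_mul]]
  induction N with
  | zero => simp
  | succ n ih => rw [Finset.sum_range_succ, ← ih]; push_cast; ring

/-- Geometric tails bound the second moment. -/
lemma lintegral_natCast_sq_le {N : Ω → ℕ} (hN : Measurable N) {c r : ℝ} (hc : 0 ≤ c) (hr : 0 ≤ r)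
    (hr1 : r < 1) (h : ∀ n, μ {ω | n < N ω} ≤ ENNReal.ofReal (c * r ^ n)) :
    ∫⁻ ω, (N ω : ℝ≥0∞) ^ 2 ∂μ ≤ ENNReal.ofReal (2 * c / (1 - r) ^ 2) := by
  have hs : ∀ n, MeasurableSet {ω | n < N ω} := fun n => hN measurableSet_Ioi
  have hsum : HasSum (fun n : ℕ => c * r ^ n * (2 * n + 1)) (c * ((1 + r) / (1 - r) ^ 2)) := by
    have h1 := (hasSum_coe_mul_geometric_of_norm_lt_one
      (show ‖r‖ < 1 by rwa [Real.norm_of_nonneg hr])).mul_left 2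
    have h2 := (h1.add (hasSum_geometric_of_lt_one hr hr1)).mul_left c
    have h3 : (1 - r) ≠ 0 := by linarith
    have h4 : c * ((1 + r) / (1 - r) ^ 2) = c * (2 * (r / (1 - r) ^ 2) + (1 - r)⁻¹) := by
      field_simp
      ring
    rw [h4]
    exact h2.congr_fun fun n => by ring
  calc ∫⁻ ω, (N ω : ℝ≥0∞) ^ 2 ∂μ
      = ∑' n : ℕ, μ {ω | n < N ω} * (2 * n + 1 : ℝ≥0∞) := by
        simp_rw [natCast_sq_eq_tsum]
        rw [lintegral_tsum fun n => ((Measurable.ite (hs n) measurable_const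
          measurable_const).mul_const _).aemeasurable]
        refine tsum_congr fun n => ?_
        rw [lintegral_mul_const _ (Measurable.ite (hs n) measurable_const measurable_const)]
        congr 1
        simpa [Set.indicator] using lintegral_indicator_one (μ := μ) (hs n)
    _ ≤ ∑' n : ℕ, ENNReal.ofReal (c * r ^ n * (2 * n + 1)) := by
        refine ENNReal.tsum_le_tsum fun n => ?_
        rw [ENNReal.ofReal_mul (by positivity)]
        gcongr
        · exact h n
        · rw [ENNReal.ofReal_add (by positivity) zero_le_one, ENNReal.ofReal_mul zero_le_two]
          simp
    _ = ENNReal.ofReal (c * ((1 + r) / (1 - r) ^ 2)) := by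
        rw [← ENNReal.ofReal_tsum_of_nonneg (fun n => by positivity) hsum.summable, hsum.tsum_eq]
    _ ≤ _ := by
        refine ENNReal.ofReal_le_ofReal ?_
        rw [← mul_div_assoc, mul_comm c]
        gcongr
        linarith

end Tails

/-! ### Exponential sums crossing a level: the Poisson law. -/

section HittingTime

lemma measurable_hittingTime {Ω : Type*} {m : MeasurableSpace Ω} {x : Ω → ℕ → ℝ}
    (hx : ∀ i, Measurable fun ω => x ω i) (c : ℝ) : Measurable fun ω => hittingTime (x ω) c :=
  measurable_sInf_nat fun _ =>
    measurableSet_le measurable_const (Finset.measurable_fun_sum _ fun i _ => hx i)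

lemma hittingTime_const_mul (x : ℕ → ℝ) {b c : ℝ} (hb : 0 < b) :
    hittingTime (fun i => b * x i) c = hittingTime x (c / b) := by
  unfold hittingTime
  simp_rw [← Finset.mul_sum, div_le_iff₀' hb]

/-- Lower tail of the Poisson distribution. -/
def poissonHead (n : ℕ) (x : ℝ) : ℝ := ∑ k ∈ Finset.range n, Real.exp (-x) * x ^ k / k !

lemma poissonHead_le_one (n : ℕ) {x : ℝ} (hx : 0 ≤ x) : poissonHead n x ≤ 1 := by
  have h := Real.sum_le_exp_of_nonneg hx n
  calc poissonHead n x = Real.exp (-x) * ∑ k ∈ Finset.range n, x ^ k / k ! := by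
        simp_rw [poissonHead, Finset.mul_sum, mul_div_assoc]
    _ ≤ Real.exp (-x) * Real.exp x := by gcongr
    _ = 1 := by rw [← Real.exp_add]; simp

lemma poissonMeasure_Ici (r : ℝ≥0) (n : ℕ) :
    poissonMeasure r (Set.Ici n) = ENNReal.ofReal (1 - poissonHead n r) := by
  have hIio : poissonMeasure r (Set.Iio n) = ENNReal.ofReal (poissonHead n r) := by
    have : Set.Iio n = ((Finset.range n : Finset ℕ) : Set ℕ) := by ext; simp
    rw [this, ← sum_measure_singleton, poissonHead,
      ENNReal.ofReal_sum_of_nonneg fun k _ => by positivity]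
    exact Finset.sum_congr rfl fun k _ => poissonMeasure_singleton r k
  have hnn : 0 ≤ poissonHead n r := Finset.sum_nonneg fun k _ => by positivity
  rw [← Set.compl_Iio, prob_compl_eq_one_sub measurableSet_Iio, hIio,
    ENNReal.ofReal_sub _ hnn, ENNReal.ofReal_one]

/-- This is the induction step for the Erlang distribution. In the integrand exp(-λy)·exp(-λ(c-y))
is constant in y, so apart from one exponential it is a polynomial and has an explicit
antiderivative. -/
lemma integral_exp_mul_poissonHead (lam c : ℝ) (n : ℕ) :
    ∫ y in (0 : ℝ)..c, lam * Real.exp (-(lam * y)) * (1 - poissonHead n (lam * (c - y))) =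
      1 - poissonHead (n + 1) (lam * c) := by
  have hderiv : ∀ y : ℝ, HasDerivAt (fun y => -Real.exp (-(lam * y)) +
      ∑ k ∈ Finset.range n, Real.exp (-(lam * c)) * (lam * (c - y)) ^ (k + 1) / (k + 1)!)
      (lam * Real.exp (-(lam * y)) * (1 - poissonHead n (lam * (c - y)))) y := by
    intro y
    have h1 : HasDerivAt (fun y => -Real.exp (-(lam * y))) (lam * Real.exp (-(lam * y))) y := by
      have := (((hasDerivAt_id y).const_mul lam).neg.exp).neg
      convert! this using 1
      simp; ring
    have h2 : ∀ k ∈ Finset.range n, HasDerivAt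
        (fun y => Real.exp (-(lam * c)) * (lam * (c - y)) ^ (k + 1) / (k + 1)!)
        (-(lam * Real.exp (-(lam * c)) * (lam * (c - y)) ^ k / k !)) y := by
      intro k _
      have h3 := (((((hasDerivAt_id y).const_sub c).const_mul lam).fun_pow (k + 1)).const_mul
        (Real.exp (-(lam * c)))).div_const ((k + 1)! : ℝ)
      convert! h3 using 1
      have : (k ! : ℝ) ≠ 0 := by positivity
      have : (k + 1 : ℝ) ≠ 0 := by positivity
      rw [Nat.factorial_succ]
      push_cast
      simp only [id]
      field_simp
    have h4 := h1.add (HasDerivAt.fun_sum h2)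
    convert! h4 using 1
    rw [poissonHead, Finset.sum_neg_distrib, mul_sub, mul_one, sub_eq_add_neg, Finset.mul_sum]
    congr 2
    refine Finset.sum_congr rfl fun k _ => ?_
    have : Real.exp (-(lam * c)) = Real.exp (-(lam * y)) * Real.exp (-(lam * (c - y))) := by
      rw [← Real.exp_add]; congr 1; ring
    rw [this]
    ring
  rw [intervalIntegral.integral_eq_sub_of_hasDerivAt (fun y _ => hderiv y)]
  · rw [poissonHead, Finset.sum_range_succ']
    simp
    ring
  · refine Continuous.intervalIntegrable ?_ _ _
    unfold poissonHead
    fun_prop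

lemma lintegral_expMeasure_poissonHead {lam c : ℝ} (hlam : 0 < lam) (hc : 0 < c) (n : ℕ) :
    ∫⁻ y, (if y < c then ENNReal.ofReal (1 - poissonHead n (lam * (c - y))) else 0)
      ∂(expMeasure lam) = ENNReal.ofReal (1 - poissonHead (n + 1) (lam * c)) := by
  have hcont : Continuous fun y =>
      lam * Real.exp (-(lam * y)) * (1 - poissonHead n (lam * (c - y))) := by
    unfold poissonHead
    fun_prop
  have hmeas : Measurable fun y => (if y < c then
      ENNReal.ofReal (1 - poissonHead n (lam * (c - y))) else 0) := by
    refine Measurable.ite measurableSet_Iio ?_ measurable_const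
    unfold poissonHead
    fun_prop
  have hdens : expMeasure lam = volume.withDensity (exponentialPDF lam) := rfl
  have hpdf : Measurable (exponentialPDF lam) :=
    (measurable_exponentialPDFReal lam).ennreal_ofReal
  rw [hdens, lintegral_withDensity_eq_lintegral_mul _ hpdf hmeas]
  calc _ = ∫⁻ y, (Set.Ico 0 c).indicator (fun y => ENNReal.ofReal
          (lam * Real.exp (-(lam * y)) * (1 - poissonHead n (lam * (c - y))))) y := by
        refine lintegral_congr fun y => ?_
        rw [Pi.mul_apply, exponentialPDF_eq]
        by_cases h0 : 0 ≤ y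
        · by_cases h1 : y < c
          · rw [Set.indicator_of_mem (Set.mem_Ico.2 ⟨h0, h1⟩), if_pos h0, if_pos h1]
            exact (ENNReal.ofReal_mul (by positivity)).symm
          · rw [Set.indicator_of_notMem fun h => h1 h.2, if_neg h1, mul_zero]
        · rw [Set.indicator_of_notMem fun h => h0 h.1, if_neg h0, ENNReal.ofReal_zero, zero_mul]
    _ = ∫⁻ y in Set.Ioc 0 c, ENNReal.ofReal
          (lam * Real.exp (-(lam * y)) * (1 - poissonHead n (lam * (c - y)))) := by
        rw [lintegral_indicator measurableSet_Ico, Measure.restrict_congr_set Ico_ae_eq_Ioc]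
    _ = _ := by
        rw [← ofReal_integral_eq_lintegral_ofReal, ← intervalIntegral.integral_of_le hc.le,
          integral_exp_mul_poissonHead]
        · exact (hcont.integrableOn_Icc).mono_set Set.Ioc_subset_Icc_self
        · refine (ae_restrict_iff' measurableSet_Ioc).2 (ae_of_all _ fun y hy => ?_)
          have := poissonHead_le_one n (mul_nonneg hlam.le (sub_nonneg.2 hy.2))
          exact mul_nonneg (by positivity) (by linarith)

lemma expMeasure_Iio_of_nonpos {lam c : ℝ} (hc : c ≤ 0) : expMeasure lam (Set.Iio c) = 0 := by
  have hdens : expMeasure lam = volume.withDensity (exponentialPDF lam) := rfl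
  rw [hdens, withDensity_apply _ measurableSet_Iio, lintegral_exponentialPDF_of_nonpos hc]

variable {lam : ℝ}

/-- The law of a sequence of independent exponential variables. -/
def expSeq (lam : ℝ) : Measure (ℕ → ℝ) := Measure.infinitePi fun _ => expMeasure lam

lemma isProbabilityMeasure_expSeq (hlam : 0 < lam) : IsProbabilityMeasure (expSeq lam) := by
  have := isProbabilityMeasure_expMeasure hlam
  unfold expSeq
  infer_instance

lemma expSeq_map_eval (hlam : 0 < lam) (n : ℕ) :
    (expSeq lam).map (fun x => x n) = expMeasure lam := by
  have := isProbabilityMeasure_expMeasure hlam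
  exact Measure.infinitePi_map_eval _ n

lemma ae_expSeq_nonneg (hlam : 0 < lam) : ∀ᵐ x ∂(expSeq lam), ∀ i, 0 ≤ x i := by
  rw [ae_all_iff]
  intro i
  have h : ∀ᵐ y ∂(expMeasure lam), 0 ≤ y := by
    rw [ae_iff]
    simp only [not_le]
    exact expMeasure_Iio_of_nonpos le_rfl
  rw [← expSeq_map_eval hlam i] at h
  exact ae_of_ae_map (measurable_pi_apply i).aemeasurable h

/-- Condition on the last summand, which is independent of the others. -/
lemma expSeq_sum_lt_succ (hlam : 0 < lam) (n : ℕ) (c : ℝ) :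
    expSeq lam {x | ∑ i ∈ Finset.range (n + 1), x i < c} =
      ∫⁻ y, expSeq lam {x | ∑ i ∈ Finset.range n, x i < c - y} ∂(expMeasure lam) := by
  have := isProbabilityMeasure_expMeasure hlam
  have := isProbabilityMeasure_expSeq hlam
  have hS : Measurable fun x : ℕ → ℝ => ∑ i ∈ Finset.range n, x i := by fun_prop
  have hind : iIndepFun (fun (i : ℕ) (x : ℕ → ℝ) => x i) (expSeq lam) :=
    iIndepFun_infinitePi (X := fun _ x => x) fun _ => measurable_id
  have h1 := hind.indepFun_finsetSum_of_notMem (fun i => measurable_pi_apply i)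
    (Finset.notMem_range_self (n := n))
  have h2 := (indepFun_iff_map_prod_eq_prod_map_map
    (Finset.aemeasurable_sum _ fun i _ => (measurable_pi_apply i).aemeasurable)
    (measurable_pi_apply n).aemeasurable).1 h1
  have hA : MeasurableSet {q : ℝ × ℝ | q.1 + q.2 < c} :=
    measurableSet_lt (by fun_prop) measurable_const
  have h3 : expSeq lam {x | ∑ i ∈ Finset.range (n + 1), x i < c} =
      (expSeq lam).map (fun x => ((∑ i ∈ Finset.range n, fun x : ℕ → ℝ => x i) x, x n))
        {q : ℝ × ℝ | q.1 + q.2 < c} := by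
    rw [Measure.map_apply (by fun_prop) hA]
    simp [Finset.sum_range_succ]
  rw [h3, h2, Measure.prod_apply_symm hA, expSeq_map_eval hlam]
  refine lintegral_congr fun y => ?_
  rw [Measure.map_apply (by fun_prop) (measurable_prodMk_right hA)]
  congr 1
  ext x
  simp [lt_sub_iff_add_lt]

lemma expSeq_sum_lt (hlam : 0 < lam) (n : ℕ) {c : ℝ} (hc : 0 < c) :
    expSeq lam {x | ∑ i ∈ Finset.range n, x i < c} =
      ENNReal.ofReal (1 - poissonHead n (lam * c)) := by
  have := isProbabilityMeasure_expSeq hlam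
  induction n generalizing c with
  | zero => simp [hc, poissonHead]
  | succ n ih =>
    rw [expSeq_sum_lt_succ hlam, ← lintegral_expMeasure_poissonHead hlam hc]
    refine lintegral_congr fun y => ?_
    split_ifs with h
    · exact ih (sub_pos.2 h)
    -- Here the last gain alone reaches the level, and the other gains are almost surely
    -- nonnegative.
    · have h0 : ∀ᵐ x ∂(expSeq lam), ¬ ∑ i ∈ Finset.range n, x i < c - y := by
        filter_upwards [ae_expSeq_nonneg hlam] with x hx
        have : 0 ≤ ∑ i ∈ Finset.range n, x i := Finset.sum_nonneg fun i _ => hx i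
        linarith [not_lt.1 h]
      rw [ae_iff] at h0
      simpa only [not_not] using h0

/-- The hitting time of a level by a sum of exponential variables is a shifted Poisson variable. -/
theorem expSeq_map_hittingTime (hlam : 0 < lam) {c : ℝ} (hc : 0 < c) {r : ℝ≥0}
    (hr : (r : ℝ) = lam * c) :
    (expSeq lam).map (fun x => hittingTime x c) = (poissonMeasure r).map (· + 1) := by
  have := isProbabilityMeasure_expSeq hlam
  have hmeas : Measurable fun x : ℕ → ℝ => hittingTime x c :=
    measurable_hittingTime (fun i => measurable_pi_apply i) c
  have := Measure.isProbabilityMeasure_map (μ := expSeq lam) hmeas.aemeasurable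
  -- The level must be reached almost surely: otherwise `sInf ∅ = 0` would misplace mass at 0.
  have hfin : ∀ᵐ x ∂(expSeq lam), ∃ j, c ≤ ∑ i ∈ Finset.range j, x i := by
    rw [ae_iff]
    have htend : Tendsto (fun n => poissonMeasure r (Set.Ici n)) atTop (𝓝 0) := by
      have := tendsto_measure_iInter_atTop (μ := poissonMeasure r) (s := fun n : ℕ => Set.Ici n)
        (fun n => (measurableSet_Ici).nullMeasurableSet)
        (fun a b hab => Set.Ici_subset_Ici.2 hab) ⟨0, measure_ne_top _ _⟩
      have he : ⋂ n : ℕ, Set.Ici n = (∅ : Set ℕ) := by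
        ext k
        simp only [Set.mem_iInter, Set.mem_Ici, Set.mem_empty_iff_false, iff_false, not_forall,
          not_le]
        exact ⟨k + 1, Nat.lt_succ_self k⟩
      rwa [he, measure_empty] at this
    refine le_antisymm (ge_of_tendsto' htend fun n => ?_) bot_le
    rw [poissonMeasure_Ici, hr, ← expSeq_sum_lt hlam n hc]
    refine measure_mono fun x hx => ?_
    simp only [not_exists, not_le] at hx
    exact hx n
  refine Measure.ext_of_Ici _ _ fun n => ?_
  rw [Measure.map_apply hmeas measurableSet_Ici,
    Measure.map_apply (measurable_of_countable _) measurableSet_Ici]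
  cases n with
  | zero => simp
  | succ n =>
    have h1 : (fun k : ℕ => k + 1) ⁻¹' Set.Ici (n + 1) = Set.Ici n := by ext; simp
    rw [h1, poissonMeasure_Ici, hr, ← expSeq_sum_lt hlam n hc]
    -- Nonnegative gains make the partial sums monotone, so needing more than n terms is the same as
    -- the first n falling short.
    refine measure_congr ?_
    filter_upwards [hfin, ae_expSeq_nonneg hlam] with x hx hx0
    refine propext ⟨fun h => ?_, fun h => ?_⟩
    · have h : n + 1 ≤ hittingTime x c := h
      change ∑ i ∈ Finset.range n, x i < c
      by_contra hcon
      have : hittingTime x c ≤ n := Nat.sInf_le (not_lt.1 hcon)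
      omega
    · have h : ∑ i ∈ Finset.range n, x i < c := h
      refine le_csInf hx fun j hj => ?_
      by_contra hlt
      have hj : c ≤ ∑ i ∈ Finset.range j, x i := hj
      have : ∑ i ∈ Finset.range j, x i ≤ ∑ i ∈ Finset.range n, x i :=
        Finset.sum_le_sum_of_subset_of_nonneg
          (Finset.range_subset_range.2 (by omega)) fun i _ _ => hx0 i
      linarith

end HittingTime

/-! ### Moments of the Poisson distribution. -/

section PoissonMoments

lemma lintegral_poissonMeasure (r : ℝ≥0) {f : ℕ → ℝ} (hf : ∀ n, 0 ≤ f n) {v : ℝ}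
    (h : HasSum (fun n => Real.exp (-r) * (r : ℝ) ^ n / n ! * f n) v) :
    ∫⁻ n, ENNReal.ofReal (f n) ∂(poissonMeasure r) = ENNReal.ofReal v := by
  rw [lintegral_countable', ← h.tsum_eq, ENNReal.ofReal_tsum_of_nonneg
    (fun n => mul_nonneg (by positivity) (hf n)) h.summable]
  refine tsum_congr fun n => ?_
  rw [poissonMeasure_singleton, mul_comm, ENNReal.ofReal_mul (by positivity)]

/-- The generating function: s = 1 gives the total mass, s = exp t the exponential moment of the
service time. -/
lemma hasSum_poisson_pow (r s : ℝ) :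
    HasSum (fun n : ℕ => Real.exp (-r) * r ^ n / n ! * s ^ n) (Real.exp (r * (s - 1))) := by
  have h := (NormedSpace.expSeries_div_hasSum_exp (r * s)).mul_left (Real.exp (-r))
  rw [← Real.exp_eq_exp_ℝ, ← Real.exp_add] at h
  have e : r * (s - 1) = -r + r * s := by ring
  rw [e]
  exact h.congr_fun fun n => by rw [mul_pow]; ring

lemma hasSum_poisson_one (r : ℝ) :
    HasSum (fun n : ℕ => Real.exp (-r) * r ^ n / n !) 1 := by
  simpa using hasSum_poisson_pow r 1

lemma hasSum_poisson_id (r : ℝ) :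
    HasSum (fun n : ℕ => Real.exp (-r) * r ^ n / n ! * n) r := by
  rw [← hasSum_nat_add_iff' 1]
  have h := (hasSum_poisson_one r).mul_left r
  rw [mul_one] at h
  simp only [Finset.range_one, Finset.sum_singleton, Nat.cast_zero, mul_zero, sub_zero]
  refine h.congr_fun fun n => ?_
  have : (n ! : ℝ) ≠ 0 := by positivity
  have : (n + 1 : ℝ) ≠ 0 := by positivity
  rw [Nat.factorial_succ]
  push_cast
  field_simp
  ring

lemma hasSum_poisson_sq (r : ℝ) :
    HasSum (fun n : ℕ => Real.exp (-r) * r ^ n / n ! * (n : ℝ) ^ 2) (r ^ 2 + r) := by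
  rw [← hasSum_nat_add_iff' 1]
  have h := ((hasSum_poisson_id r).add (hasSum_poisson_one r)).mul_left r
  simp only [Finset.range_one, Finset.sum_singleton, Nat.cast_zero, ne_eq, OfNat.ofNat_ne_zero,
    not_false_eq_true, zero_pow, mul_zero, sub_zero]
  have e : r ^ 2 + r = r * (r + 1) := by ring
  rw [e]
  refine h.congr_fun fun n => ?_
  have : (n ! : ℝ) ≠ 0 := by positivity
  have : (n + 1 : ℝ) ≠ 0 := by positivity
  rw [Nat.factorial_succ]
  push_cast
  field_simp
  ring

/-- Since max(1, n) exceeds n only at n = 0, and by 1, this term is the correction exp(-λ/η) in both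
moments of the idle-block count. -/
lemma hasSum_poisson_zero (r : ℝ) :
    HasSum (fun n : ℕ => Real.exp (-r) * r ^ n / n ! * (if n = 0 then 1 else 0))
      (Real.exp (-r)) := by
  have h := hasSum_ite_eq 0 (Real.exp (-r))
  refine h.congr_fun fun n => ?_
  split_ifs with hn
  · subst hn; simp
  · simp

end PoissonMoments

/-! ### Independence of families of random inputs. -/

section Coordinates

/-- The labels of all random inputs. -/
abbrev Label : Type := GainIdx ⊕ ArrivalIdx

/-- The `σ`-algebra generated by one random input. -/
@[reducible] def coordSigma : Label → MeasurableSpace Sample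
  | .inl g => MeasurableSpace.comap (fun ω => ω.1 g) inferInstance
  | .inr a => MeasurableSpace.comap (fun ω => ω.2 a) inferInstance

/-- The `σ`-algebra generated by a set of random inputs. -/
@[reducible] def blockSigma (A : Set Label) : MeasurableSpace Sample := ⨆ x ∈ A, coordSigma x

lemma coordSigma_le (x : Label) : coordSigma x ≤ (inferInstance : MeasurableSpace Sample) := by
  rcases x with g | a
  · exact Measurable.comap_le (by fun_prop)
  · exact Measurable.comap_le (by fun_prop)

lemma blockSigma_le (A : Set Label) : blockSigma A ≤ (inferInstance : MeasurableSpace Sample) :=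
  iSup₂_le fun x _ => coordSigma_le x

lemma blockSigma_mono {A B : Set Label} (h : A ⊆ B) : blockSigma A ≤ blockSigma B :=
  biSup_mono h

lemma measurable_gain {A : Set Label} {g : GainIdx} (h : .inl g ∈ A) :
    Measurable[blockSigma A] fun ω : Sample => ω.1 g := by
  have h1 : Measurable[coordSigma (.inl g)] fun ω : Sample => ω.1 g := comap_measurable _
  exact h1.mono (le_iSup₂_of_le _ h le_rfl) le_rfl

lemma measurable_arrival {A : Set Label} {a : ArrivalIdx} (h : .inr a ∈ A) :
    Measurable[blockSigma A] fun ω : Sample => ω.2 a := by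
  have h1 : Measurable[coordSigma (.inr a)] fun ω : Sample => ω.2 a := comap_measurable _
  exact h1.mono (le_iSup₂_of_le _ h le_rfl) le_rfl

namespace System

variable (s : System)

instance isProbabilityMeasure_law : IsProbabilityMeasure s.law := by
  have := isProbabilityMeasure_expMeasure s.lam_pos
  unfold law
  infer_instance

lemma law_rectangle (I : Finset GainIdx) (J : Finset ArrivalIdx) {t : GainIdx → Set ℝ}
    {u : ArrivalIdx → Set Bool} (ht : ∀ g ∈ I, MeasurableSet (t g)) :
    s.law ((Set.pi I t) ×ˢ (Set.pi J u)) =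
      (∏ g ∈ I, expMeasure s.lam (t g)) * ∏ a ∈ J, bernoulliMeasure true false s.p (u a) := by
  have := isProbabilityMeasure_expMeasure s.lam_pos
  unfold law
  rw [Measure.prod_prod, Measure.infinitePi_pi _ ht,
    Measure.infinitePi_pi _ fun a _ => MeasurableSet.of_discrete]

/-- A finite intersection of coordinate events is a rectangle, on which the product law factorizes.
-/
lemma iIndep_coordSigma : iIndep coordSigma s.law := by
  rw [iIndep_iff]
  intro S f hf
  have hL : ∀ g : GainIdx, ∃ t : Set ℝ, .inl g ∈ S →
      MeasurableSet t ∧ (fun ω : Sample => ω.1 g) ⁻¹' t = f (.inl g) := fun g => by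
    by_cases h : .inl g ∈ S
    · obtain ⟨t, ht⟩ := hf _ h
      exact ⟨t, fun _ => ht⟩
    · exact ⟨∅, fun h' => absurd h' h⟩
  have hR : ∀ a : ArrivalIdx, ∃ t : Set Bool, .inr a ∈ S →
      (fun ω : Sample => ω.2 a) ⁻¹' t = f (.inr a) := fun a => by
    by_cases h : .inr a ∈ S
    · obtain ⟨t, ht⟩ := hf _ h
      exact ⟨t, fun _ => ht.2⟩
    · exact ⟨∅, fun h' => absurd h' h⟩
  choose t ht using hL
  choose u hu using hR
  have hrect : ⋂ x ∈ S, f x = (Set.pi S.toLeft t) ×ˢ (Set.pi S.toRight u) := by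
    ext ω
    simp only [Set.mem_iInter, Set.mem_prod, Set.mem_pi, Finset.mem_coe, Finset.mem_toLeft,
      Finset.mem_toRight]
    constructor
    · intro h
      refine ⟨fun g hg => ?_, fun a ha => ?_⟩
      · have := h _ hg
        rwa [← (ht g hg).2] at this
      · have := h _ ha
        rwa [← hu a ha] at this
    · rintro ⟨h1, h2⟩ (g | a) hx
      · rw [← (ht g hx).2]
        exact h1 g hx
      · rw [← hu a hx]
        exact h2 a hx
  rw [hrect, s.law_rectangle _ _ fun g hg => (ht g (Finset.mem_toLeft.1 hg)).1,
    Finset.prod_sum_eq_prod_toLeft_mul_prod_toRight]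
  congr 1
  · refine Finset.prod_congr rfl fun g hg => ?_
    have hg := Finset.mem_toLeft.1 hg
    have h := s.law_rectangle {g} ∅ (t := t) (u := u) (by simpa using (ht g hg).1)
    rw [← (ht g hg).2]
    simp only [Finset.prod_singleton, Finset.prod_empty, mul_one] at h
    rw [← h]
    congr 1
    ext ω
    simp
  · refine Finset.prod_congr rfl fun a ha => ?_
    have ha := Finset.mem_toRight.1 ha
    have h := s.law_rectangle ∅ {a} (t := t) (u := u) (by simp)
    rw [← hu a ha]
    simp only [Finset.prod_singleton, Finset.prod_empty, one_mul] at h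
    rw [← h]
    congr 1
    ext ω
    simp

/-- Independence claims for composite quantities reduce to this: two variables built from disjoint
sets of labels are independent. -/
lemma indep_blockSigma {A B : Set Label} (h : ∀ x, x ∈ A → x ∉ B) :
    Indep (blockSigma A) (blockSigma B) s.law :=
  indep_iSup_of_disjoint coordSigma_le s.iIndep_coordSigma (Set.disjoint_left.2 fun x => h x)

lemma indepFun_of_blockSigma {A B : Set Label} (h : ∀ x, x ∈ A → x ∉ B) {β γ : Type*}
    [MeasurableSpace β] [MeasurableSpace γ] {X : Sample → β} {Y : Sample → γ}
    (hX : Measurable[blockSigma A] X) (hY : Measurable[blockSigma B] Y) : IndepFun X Y s.law := by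
  rw [IndepFun_iff_Indep]
  exact indep_of_indep_of_le_right (indep_of_indep_of_le_left (s.indep_blockSigma h) hX.comap_le)
    hY.comap_le

/-- Relabelling the inputs injectively preserves the law. -/
lemma measurePreserving_relabel {e : GainIdx → GainIdx} {f : ArrivalIdx → ArrivalIdx}
    (he : Function.Injective e) (hf : Function.Injective f) :
    MeasurePreserving (fun ω : Sample => ((fun g => ω.1 (e g), fun a => ω.2 (f a)) : Sample))
      s.law s.law := by
  have := isProbabilityMeasure_expMeasure s.lam_pos
  have h1 : MeasurePreserving (fun (x : GainIdx → ℝ) g => x (e g))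
      (Measure.infinitePi fun _ : GainIdx => expMeasure s.lam)
      (Measure.infinitePi fun _ : GainIdx => expMeasure s.lam) :=
    ⟨by fun_prop, Measure.map_infinitePi_infinitePi_of_inj he⟩
  have h2 : MeasurePreserving (fun (x : ArrivalIdx → Bool) a => x (f a))
      (Measure.infinitePi fun _ : ArrivalIdx => bernoulliMeasure true false s.p)
      (Measure.infinitePi fun _ : ArrivalIdx => bernoulliMeasure true false s.p) :=
    ⟨by fun_prop, Measure.map_infinitePi_infinitePi_of_inj hf⟩
  exact h1.prod h2

lemma measurePreserving_gains {e : ℕ → GainIdx} (he : Function.Injective e) :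
    MeasurePreserving (fun (ω : Sample) i => ω.1 (e i)) s.law (expSeq s.lam) := by
  have := isProbabilityMeasure_expMeasure s.lam_pos
  refine MeasurePreserving.comp (g := fun (x : GainIdx → ℝ) i => x (e i)) (f := Prod.fst)
    (μb := Measure.infinitePi fun _ : GainIdx => expMeasure s.lam)
    ⟨by fun_prop, Measure.map_infinitePi_infinitePi_of_inj he⟩ ?_
  exact measurePreserving_fst

lemma law_arrivals_true (J : Finset ArrivalIdx) :
    s.law {ω | ∀ a ∈ J, ω.2 a = true} = ENNReal.ofReal (s.p : ℝ) ^ J.card := by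
  have h := s.law_rectangle ∅ J (t := fun _ => Set.univ) (u := fun _ => {true}) (by simp)
  have hp : bernoulliMeasure true false s.p {true} = ENNReal.ofReal (s.p : ℝ) := by
    rw [bernoulliMeasure_apply_of_mem_of_notMem _ (by simp) (by simp) (by simp)]
    rw [ENNReal.ofReal, ENNReal.coe_inj]
    ext
    simp [unitInterval.nonneg]
  simp only [hp, Finset.prod_const, Finset.card_empty, pow_zero, one_mul] at h
  rw [← h]
  congr 1
  ext ω
  simp [Set.mem_pi]

lemma lintegral_arrival (a : ArrivalIdx) (x y : ℝ≥0∞) :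
    ∫⁻ ω, (if ω.2 a = true then x else y) ∂s.law =
      ENNReal.ofReal (s.p : ℝ) * x + ENNReal.ofReal (1 - (s.p : ℝ)) * y := by
  have hm : Measurable fun ω : Sample => ω.2 a := by fun_prop
  have hT : MeasurableSet {ω : Sample | ω.2 a = true} := hm (measurableSet_singleton true)
  have h1 : s.law {ω | ω.2 a = true} = ENNReal.ofReal (s.p : ℝ) := by
    simpa using s.law_arrivals_true {a}
  have h2 : s.law {ω | ω.2 a = true}ᶜ = ENNReal.ofReal (1 - (s.p : ℝ)) := by
    rw [prob_compl_eq_one_sub hT, h1, ENNReal.ofReal_sub _ (unitInterval.nonneg _),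
      ENNReal.ofReal_one]
  have e1 : ∫⁻ ω in {ω | ω.2 a = true}, (if ω.2 a = true then x else y) ∂s.law =
      ∫⁻ _ in {ω | ω.2 a = true}, x ∂s.law :=
    setLIntegral_congr_fun hT fun ω hω => if_pos hω
  have e2 : ∫⁻ ω in {ω | ω.2 a = true}ᶜ, (if ω.2 a = true then x else y) ∂s.law =
      ∫⁻ _ in {ω | ω.2 a = true}ᶜ, y ∂s.law :=
    setLIntegral_congr_fun hT.compl fun ω hω => if_neg hω
  rw [← lintegral_add_compl _ hT, e1, e2, setLIntegral_const, setLIntegral_const, h1, h2,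
    mul_comm x, mul_comm y]

end System

end Coordinates

/-! ### Bookkeeping: which inputs each quantity depends on. -/

namespace Label

/-- The uplink packet to which a random input belongs. -/
def packet : Label → ℕ
  | .inl (.uplink k _) => k
  | .inl (.harvest k _ _) => k
  | .inl (.downlink k _ _ _ _) => k
  | .inr (.start k _ _) => k
  | .inr (.during k _ _ _) => k

/-- The role of a random input: `0` for uplink gains, `1` for harvesting, `2` for the start of busy
periods, `3` for the gains and `4` for the arrivals during a busy period. -/
def kind : Label → ℕ
  | .inl (.uplink _ _) => 0
  | .inl (.harvest _ _ _) => 1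
  | .inl (.downlink _ _ _ _ _) => 3
  | .inr (.start _ _ _) => 2
  | .inr (.during _ _ _ _) => 4

/-- The block of the uplink packet to which a random input belongs. -/
def block : Label → ℕ
  | .inl (.uplink _ i) => i
  | .inl (.harvest _ i _) => i
  | .inl (.downlink _ i _ _ _) => i
  | .inr (.start _ i _) => i
  | .inr (.during _ i _ _) => i

end Label

open Label

namespace System

variable (s : System)

section Measurability

variable {m : MeasurableSpace Sample}

lemma measurable_service {g : ℕ → Sample → ℝ} (h : ∀ i, Measurable (g i)) :
    Measurable fun ω => s.service fun i => g i ω :=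
  measurable_hittingTime (x := fun ω i => s.info (g i ω))
    (fun i => (((h i).mul_const _).mul_const _).div_const _) _

lemma measurable_upService {k : ℕ} (h : ∀ i, Measurable fun ω : Sample => ω.1 (.uplink k i)) :
    Measurable fun ω => s.upService ω k :=
  s.measurable_service h

lemma measurable_energy {g : Sample → ℝ} (h : Measurable g) : Measurable fun ω => s.energy (g ω) :=
  ((h.const_mul _).mul_const _).mul_const _

lemma measurable_harvestTime {k i : ℕ}
    (h : ∀ j, Measurable fun ω : Sample => ω.1 (.harvest k i j)) :
    Measurable fun ω => s.harvestTime ω k i :=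
  measurable_sInf_nat fun _ => measurableSet_le measurable_const
    ((s.measurable_energy (h 0)).add
      (Finset.measurable_fun_sum _ fun l _ => s.measurable_energy (h (l + 1))))

lemma measurable_maxHarvest {k i : ℕ}
    (h : ∀ j, Measurable fun ω : Sample => ω.1 (.harvest k i j)) :
    Measurable fun ω => max 1 (s.harvestTime ω k i) :=
  measurable_const.max (s.measurable_harvestTime h)

lemma measurable_upServiceTime {k : ℕ}
    (hu : ∀ i, Measurable fun ω : Sample => ω.1 (.uplink k i))
    (hh : ∀ i j, Measurable fun ω : Sample => ω.1 (.harvest k i j)) :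
    Measurable fun ω => s.upServiceTime ω k :=
  measurable_sum_range_random (s.measurable_upService hu) fun i => s.measurable_maxHarvest (hh i)

lemma measurable_numBusy {k i : ℕ} (h : ∀ j, Measurable fun ω : Sample => ω.2 (.start k i j)) :
    Measurable fun ω => numBusy ω k i :=
  measurable_sInf_nat fun j => h j (measurableSet_singleton false)

lemma measurable_arrivalCount {k i j : ℕ}
    (h : ∀ n, Measurable fun ω : Sample => ω.2 (.during k i j n)) (n : ℕ) :
    Measurable fun ω : Sample =>
      ((Finset.range n).filter (fun t => ω.2 (.during k i j t) = true)).card := by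
  simp_rw [Finset.card_filter]
  exact Finset.measurable_fun_sum _ fun t _ =>
    Measurable.ite (h t (measurableSet_singleton true)) measurable_const measurable_const

lemma measurable_downBusy {k i j : ℕ}
    (hd : ∀ l n, Measurable fun ω : Sample => ω.1 (.downlink k i j l n))
    (ha : ∀ n, Measurable fun ω : Sample => ω.2 (.during k i j n)) :
    Measurable fun ω => s.downBusy ω k i j :=
  measurable_sInf_nat fun n => measurableSet_le
    (measurable_sum_range_random ((measurable_arrivalCount ha n).const_add 1)
      fun l => s.measurable_service (hd l)) measurable_const

/-- Total length of the busy periods just before a block of the uplink service time. -/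
def busyDelay (ω : Sample) (k i : ℕ) : ℕ := ∑ j ∈ Finset.range (numBusy ω k i), s.downBusy ω k i j

lemma measurable_busyDelay {k i : ℕ}
    (hs : ∀ j, Measurable fun ω : Sample => ω.2 (.start k i j))
    (hd : ∀ j l n, Measurable fun ω : Sample => ω.1 (.downlink k i j l n))
    (ha : ∀ j n, Measurable fun ω : Sample => ω.2 (.during k i j n)) :
    Measurable fun ω => s.busyDelay ω k i :=
  measurable_sum_range_random (measurable_numBusy hs) fun j => s.measurable_downBusy (hd j) (ha j)

/-- Exhibits T as a random sum in which the number of terms and the terms use different kinds of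
labels. -/
lemma systemTime_eq_sum (ω : Sample) (k : ℕ) :
    s.systemTime ω k = ∑ i ∈ Finset.range (s.upServiceTime ω k), (1 + s.busyDelay ω k i) := by
  simp [systemTime, busyDelay, Finset.sum_add_distrib]

end Measurability

lemma upService_mem (k : ℕ) :
    Measurable[blockSigma {x | packet x = k ∧ kind x = 0}] fun ω => s.upService ω k :=
  s.measurable_upService (m := blockSigma _) fun _ => measurable_gain ⟨rfl, rfl⟩

lemma maxHarvest_mem (k i : ℕ) :
    Measurable[blockSigma {x | packet x = k ∧ kind x = 1 ∧ block x = i}]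
      fun ω => max 1 (s.harvestTime ω k i) :=
  s.measurable_maxHarvest (m := blockSigma _) fun _ => measurable_gain ⟨rfl, rfl, rfl⟩

lemma upServiceTime_mem (k : ℕ) :
    Measurable[blockSigma {x | packet x = k ∧ kind x ≤ 1}] fun ω => s.upServiceTime ω k :=
  s.measurable_upServiceTime (m := blockSigma _) (fun _ => measurable_gain ⟨rfl, zero_le_one⟩)
    fun _ _ => measurable_gain ⟨rfl, le_rfl⟩

lemma numBusy_mem (k i : ℕ) :
    Measurable[blockSigma {x | packet x = k ∧ kind x = 2 ∧ block x = i}]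
      fun ω => numBusy ω k i :=
  measurable_numBusy (m := blockSigma _) fun _ => measurable_arrival ⟨rfl, rfl, rfl⟩

/-- The label set does not resolve `j`, so the busy periods before one block are not recorded as
mutually independent; their sum is later squared by Cauchy–Schwarz instead. -/
lemma downBusy_mem (k i j : ℕ) :
    Measurable[blockSigma {x | packet x = k ∧ 3 ≤ kind x ∧ block x = i}]
      fun ω => s.downBusy ω k i j :=
  s.measurable_downBusy (m := blockSigma _)
    (fun _ _ => measurable_gain ⟨rfl, le_rfl, rfl⟩)
    fun _ => measurable_arrival ⟨rfl, by simp [kind], rfl⟩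

lemma busyDelay_mem (k i : ℕ) :
    Measurable[blockSigma {x | packet x = k ∧ 2 ≤ kind x ∧ block x = i}]
      fun ω => s.busyDelay ω k i :=
  s.measurable_busyDelay (m := blockSigma _)
    (fun _ => measurable_arrival ⟨rfl, le_rfl, rfl⟩)
    (fun _ _ _ => measurable_gain ⟨rfl, by simp [kind], rfl⟩)
    fun _ _ => measurable_arrival ⟨rfl, by simp [kind], rfl⟩

lemma systemTime_mem (k : ℕ) :
    Measurable[blockSigma {x | packet x = k}] fun ω => s.systemTime ω k := by
  simp_rw [systemTime_eq_sum]
  refine measurable_sum_range_random (m := blockSigma _)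
    ((s.upServiceTime_mem k).mono (blockSigma_mono fun x hx => hx.1) le_rfl) fun i => ?_
  exact Measurable.const_add
    ((s.busyDelay_mem k i).mono (blockSigma_mono fun x hx => hx.1) le_rfl) 1

lemma measurable_systemTime (k : ℕ) : Measurable fun ω => s.systemTime ω k :=
  (s.systemTime_mem k).mono (blockSigma_le _) le_rfl

/-! ### Exact moments of the uplink service time. -/

section Service

lemma theta_pos : 0 < s.theta :=
  div_pos (mul_pos (mul_pos s.lam_pos s.N0_pos) s.ell_pos) (mul_pos s.Pt_pos s.TB_pos)

lemma ratio_pos : 0 < s.ratio := div_pos s.lam_pos s.eta_pos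

lemma service_map {e : ℕ → GainIdx} (he : Function.Injective e) :
    s.law.map (fun ω => s.service fun i => ω.1 (e i)) =
      (poissonMeasure s.theta.toNNReal).map (· + 1) := by
  have hb : 0 < s.Pt * s.TB / s.N0 := div_pos (mul_pos s.Pt_pos s.TB_pos) s.N0_pos
  have hc : 0 < s.ell / (s.Pt * s.TB / s.N0) := div_pos s.ell_pos hb
  rw [← expSeq_map_hittingTime s.lam_pos hc, ← (s.measurePreserving_gains he).map_eq,
    Measure.map_map (measurable_hittingTime (fun i => measurable_pi_apply i) _)
      (s.measurePreserving_gains he).measurable]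
  · congr 1
    funext ω
    change hittingTime (fun i => s.info (ω.1 (e i))) s.ell = _
    rw [Function.comp_apply, ← hittingTime_const_mul _ hb]
    congr 1
    funext i
    unfold info
    ring
  · rw [Real.coe_toNNReal _ s.theta_pos.le]
    have := s.N0_pos.ne'
    have := s.Pt_pos.ne'
    have := s.TB_pos.ne'
    unfold theta
    field_simp

lemma lintegral_service {e : ℕ → GainIdx} (he : Function.Injective e) {f : ℕ → ℝ}
    (hf : ∀ n, 0 ≤ f n) {v : ℝ}
    (h : HasSum (fun n => Real.exp (-s.theta) * s.theta ^ n / n ! * f (n + 1)) v) :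
    ∫⁻ ω, ENNReal.ofReal (f (s.service fun i => ω.1 (e i))) ∂s.law = ENNReal.ofReal v := by
  have hm : Measurable fun ω : Sample => s.service fun i => ω.1 (e i) :=
    s.measurable_service fun i => by fun_prop
  rw [← lintegral_map (f := fun n => ENNReal.ofReal (f n)) (measurable_of_countable _) hm,
    s.service_map he, lintegral_map (measurable_of_countable _) (measurable_of_countable _)]
  refine lintegral_poissonMeasure _ (fun n => hf (n + 1)) ?_
  rwa [Real.coe_toNNReal _ s.theta_pos.le]

lemma uplink_injective (k : ℕ) : Function.Injective (GainIdx.uplink k) := fun i j h => by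
  simpa using h

lemma lintegral_upService (k : ℕ) :
    ∫⁻ ω, s.upService ω k ∂s.law = ENNReal.ofReal (s.theta + 1) := by
  have h := s.lintegral_service (uplink_injective k) (f := fun n => (n : ℝ))
    (fun n => by positivity) (((hasSum_poisson_id s.theta).add (hasSum_poisson_one s.theta)).congr_fun
      fun n => by push_cast; ring)
  simpa only [ENNReal.ofReal_natCast] using! h

lemma lintegral_upService_sq (k : ℕ) :
    ∫⁻ ω, (s.upService ω k : ℝ≥0∞) ^ 2 ∂s.law =
      ENNReal.ofReal (s.theta ^ 2 + s.theta + 2 * s.theta + 1) := by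
  have h := s.lintegral_service (uplink_injective k) (f := fun n => (n : ℝ) ^ 2)
    (fun n => by positivity) ((((hasSum_poisson_sq s.theta).add
      ((hasSum_poisson_id s.theta).mul_left 2)).add (hasSum_poisson_one s.theta)).congr_fun
      fun n => by push_cast; ring)
  rw [← h]
  refine lintegral_congr fun ω => ?_
  rw [ENNReal.ofReal_pow (by positivity), ENNReal.ofReal_natCast]
  rfl

lemma ae_one_le_upService (k : ℕ) : ∀ᵐ ω ∂s.law, 1 ≤ s.upService ω k := by
  have hm : Measurable fun ω : Sample => s.service fun i => ω.1 (.uplink k i) :=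
    s.measurable_service fun i => by fun_prop
  refine ae_of_ae_map (p := fun n => 1 ≤ n) hm.aemeasurable ?_
  rw [s.service_map (uplink_injective k),
    ae_map_iff (measurable_of_countable _).aemeasurable MeasurableSet.of_discrete]
  exact ae_of_all _ fun n => by simp

/-- The remaining energy counts as the first summand of a hitting-time problem at level 1/η, and
that summand costs no idle block. Hence τ_H is Poisson without the shift by one. If the level is
never reached, both sides are 0. -/
lemma harvestTime_eq (ω : Sample) (k i : ℕ) :
    s.harvestTime ω k i = hittingTime (fun j => ω.1 (.harvest k i j)) s.eta⁻¹ - 1 := by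
  have hc : 0 < s.Pt * s.TB := mul_pos s.Pt_pos s.TB_pos
  have hb : 0 < s.eta * s.Pt * s.TB := mul_pos (mul_pos s.eta_pos s.Pt_pos) s.TB_pos
  have h1 : s.eta⁻¹ = s.Pt * s.TB / (s.eta * s.Pt * s.TB) := by
    have := s.eta_pos.ne'
    have := s.Pt_pos.ne'
    have := s.TB_pos.ne'
    field_simp
  rw [h1, ← hittingTime_const_mul _ hb]
  set P : ℕ → Prop := fun j =>
    s.Pt * s.TB ≤ ∑ l ∈ Finset.range j, s.eta * s.Pt * s.TB * ω.1 (.harvest k i l)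
  have h2 : s.harvestTime ω k i = sInf {j | P (j + 1)} := by
    unfold harvestTime
    congr 1
    ext j
    have h3 : ∀ g, s.energy g = s.eta * s.Pt * s.TB * g := fun g => by unfold energy; ring
    simp only [Set.mem_ofPred_eq, P, Finset.sum_range_succ' _ j, h3]
    rw [add_comm]
  have h3 : hittingTime (fun j => s.eta * s.Pt * s.TB * ω.1 (.harvest k i j)) (s.Pt * s.TB) =
      sInf {j | P j} := rfl
  rw [h2, h3]
  have h0 : ¬ P 0 := by simpa [P] using hc
  rcases Set.eq_empty_or_nonempty {j | P j} with he | hne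
  · have he' : {j | P (j + 1)} = ∅ := Set.eq_empty_of_forall_notMem fun j hj => by
      have : j + 1 ∈ {j | P j} := hj
      simp [he] at this
    simp [he, he']
  · have hpos : 0 < sInf {j | P j} := by
      refine Nat.pos_of_ne_zero fun h => h0 ?_
      have := Nat.sInf_mem hne
      rwa [h] at this
    rw [← Nat.sInf_add hpos]
    rfl

lemma harvest_injective (k i : ℕ) : Function.Injective (GainIdx.harvest k i) := fun j l h => by
  simpa using h

lemma lintegral_maxHarvest_apply (k i : ℕ) {f : ℕ → ℝ} (hf : ∀ n, 0 ≤ f n) {v : ℝ}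
    (h : HasSum (fun n => Real.exp (-s.ratio) * s.ratio ^ n / n ! * f (max 1 n)) v) :
    ∫⁻ ω, ENNReal.ofReal (f (max 1 (s.harvestTime ω k i))) ∂s.law = ENNReal.ofReal v := by
  have hm1 : Measurable fun x : ℕ → ℝ => hittingTime x s.eta⁻¹ :=
    measurable_hittingTime (fun i => measurable_pi_apply i) _
  simp_rw [harvestTime_eq]
  rw [(s.measurePreserving_gains (harvest_injective k i)).lintegral_comp
    (f := fun x => ENNReal.ofReal (f (max 1 (hittingTime x s.eta⁻¹ - 1))))
    ((measurable_of_countable fun n : ℕ => ENNReal.ofReal (f (max 1 (n - 1)))).comp hm1),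
    ← lintegral_map (f := fun n : ℕ => ENNReal.ofReal (f (max 1 (n - 1))))
    (measurable_of_countable _) hm1,
    expSeq_map_hittingTime s.lam_pos (inv_pos.2 s.eta_pos) (r := s.ratio.toNNReal)
    (by rw [Real.coe_toNNReal _ s.ratio_pos.le]; rfl),
    lintegral_map (measurable_of_countable _) (measurable_of_countable _)]
  refine lintegral_poissonMeasure _ (fun n => hf _) ?_
  rw [Real.coe_toNNReal _ s.ratio_pos.le]
  simpa using h

/-- Mean number of idle blocks per transmission block. -/
def meanIdle : ℝ := s.ratio + Real.exp (-s.ratio)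

/-- Second moment of the number of idle blocks per transmission block. -/
def sqIdle : ℝ := s.ratio ^ 2 + s.ratio + Real.exp (-s.ratio)

lemma one_le_meanIdle : 1 ≤ s.meanIdle := by
  have := Real.add_one_le_exp (-s.ratio)
  unfold meanIdle
  linarith

lemma sqIdle_pos : 0 < s.sqIdle := by
  have := s.ratio_pos
  unfold sqIdle
  positivity

lemma lintegral_maxHarvest (k i : ℕ) :
    ∫⁻ ω, ((max 1 (s.harvestTime ω k i) : ℕ) : ℝ≥0∞) ∂s.law = ENNReal.ofReal s.meanIdle := by
  have h := s.lintegral_maxHarvest_apply k i (f := fun n => (n : ℝ)) (fun n => by positivity)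
    (((hasSum_poisson_id s.ratio).add (hasSum_poisson_zero s.ratio)).congr_fun fun n => by
      rcases n with _ | n <;> simp)
  simpa only [ENNReal.ofReal_natCast] using! h

lemma lintegral_maxHarvest_sq (k i : ℕ) :
    ∫⁻ ω, ((max 1 (s.harvestTime ω k i) : ℕ) : ℝ≥0∞) ^ 2 ∂s.law = ENNReal.ofReal s.sqIdle := by
  have h := s.lintegral_maxHarvest_apply k i (f := fun n => (n : ℝ) ^ 2) (fun n => by positivity)
    (((hasSum_poisson_sq s.ratio).add (hasSum_poisson_zero s.ratio)).congr_fun fun n => by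
      rcases n with _ | n <;> simp)
  simpa only [ENNReal.ofReal_pow (Nat.cast_nonneg _), ENNReal.ofReal_natCast] using! h

lemma indep_upService_harvest (k : ℕ) :
    Indep (blockSigma {x | packet x = k ∧ kind x = 0}) (blockSigma {x | packet x = k ∧ kind x = 1})
      s.law :=
  s.indep_blockSigma fun _ h1 h2 => by
    have := h1.2
    have := h2.2
    omega

lemma maxHarvest_mem' (k i : ℕ) : Measurable[blockSigma {x | packet x = k ∧ kind x = 1}]
    fun ω => ((max 1 (s.harvestTime ω k i) : ℕ) : ℝ≥0∞) :=
  measurable_from_top.comp ((s.maxHarvest_mem k i).mono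
    (blockSigma_mono fun _ hx => ⟨hx.1, hx.2.1⟩) le_rfl)

lemma indepFun_maxHarvest (k : ℕ) (i j : ℕ) (h : i < j) :
    IndepFun (fun ω => ((max 1 (s.harvestTime ω k i) : ℕ) : ℝ≥0∞))
      (fun ω => ((max 1 (s.harvestTime ω k j) : ℕ) : ℝ≥0∞)) s.law :=
  s.indepFun_of_blockSigma (fun _ h1 h2 => h.ne (h1.2.2.symm.trans h2.2.2))
    (measurable_from_top.comp (s.maxHarvest_mem k i))
    (measurable_from_top.comp (s.maxHarvest_mem k j))

/-- Mean uplink service time. -/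
def meanUp : ℝ := (s.theta + 1) * s.meanIdle

/-- Second moment of the uplink service time. -/
def sqUp : ℝ := (s.theta + 1) * s.sqIdle + (s.theta ^ 2 + 2 * s.theta) * s.meanIdle ^ 2

lemma lintegral_upServiceTime (k : ℕ) :
    ∫⁻ ω, s.upServiceTime ω k ∂s.law = ENNReal.ofReal s.meanUp := by
  have h := lintegral_random_sum (blockSigma_le _) (blockSigma_le _) (s.indep_upService_harvest k)
    (s.upService_mem k) (s.maxHarvest_mem' k) (s.lintegral_maxHarvest k)
  rw [s.lintegral_upService, ← ENNReal.ofReal_mul (by linarith [s.theta_pos])] at h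
  rw [meanUp, ← h]
  exact lintegral_congr fun ω => by rw [upServiceTime]; push_cast; rfl

lemma lintegral_upServiceTime_sq (k : ℕ) :
    ∫⁻ ω, (s.upServiceTime ω k : ℝ≥0∞) ^ 2 ∂s.law = ENNReal.ofReal s.sqUp := by
  have hθ := s.theta_pos
  have hv := s.sqIdle_pos
  have ha := s.one_le_meanIdle
  have h := lintegral_random_sum_sq (blockSigma_le _) (blockSigma_le _)
    (s.indep_upService_harvest k) (s.upService_mem k) (s.maxHarvest_mem' k)
    (s.indepFun_maxHarvest k) (s.lintegral_maxHarvest k) (s.lintegral_maxHarvest_sq k)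
  have he : ∀ ω, (s.upServiceTime ω k : ℝ≥0∞) = ∑ i ∈ Finset.range (s.upService ω k),
      ((max 1 (s.harvestTime ω k i) : ℕ) : ℝ≥0∞) := fun ω => by
    rw [upServiceTime]; push_cast; rfl
  simp_rw [he]
  rw [s.lintegral_upService, s.lintegral_upService_sq, ← ENNReal.ofReal_pow (by linarith),
    ← ENNReal.ofReal_mul (by linarith), ← ENNReal.ofReal_mul (by linarith),
    ← ENNReal.ofReal_mul (by positivity), ← ENNReal.ofReal_add (by positivity) (by positivity)] at h
  -- The coefficient θ² + 2θ in `sqUp` is E S² - E S.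
  have h2 : (s.theta + 1) * s.sqIdle + (s.theta ^ 2 + s.theta + 2 * s.theta + 1) * s.meanIdle ^ 2 =
      s.sqUp + (s.theta + 1) * s.meanIdle ^ 2 := by
    unfold sqUp
    ring
  rw [h2, ENNReal.ofReal_add (by unfold sqUp; positivity) (by positivity)] at h
  exact (ENNReal.add_left_inj ENNReal.ofReal_ne_top).1 h

lemma ae_one_le_upServiceTime (k : ℕ) : ∀ᵐ ω ∂s.law, 1 ≤ s.upServiceTime ω k := by
  filter_upwards [s.ae_one_le_upService k] with ω hω
  calc 1 ≤ max 1 (s.harvestTime ω k 0) := le_max_left _ _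
    _ ≤ s.upServiceTime ω k := Finset.single_le_sum
        (f := fun i => max 1 (s.harvestTime ω k i)) (fun i _ => Nat.zero_le _)
        (Finset.mem_range.2 hω)

lemma upServiceTime_le_systemTime (ω : Sample) (k : ℕ) :
    s.upServiceTime ω k ≤ s.systemTime ω k := Nat.le_add_right _ _

end Service

end System

/-! ### Downlink busy periods and the moments of the system time. -/

namespace System

variable (s : System)

lemma lintegral_prod_range_eq {A : ℕ → Set Label} (hA : ∀ i j, i < j → ∀ x, x ∈ A i → x ∉ A j)
    {Z : ℕ → Sample → ℝ≥0∞} (hZ : ∀ i, Measurable[blockSigma (A i)] (Z i)) (n : ℕ) :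
    ∫⁻ ω, ∏ i ∈ Finset.range n, Z i ω ∂s.law = ∏ i ∈ Finset.range n, ∫⁻ ω, Z i ω ∂s.law := by
  induction n with
  | zero => simp
  | succ n ih =>
    simp_rw [Finset.prod_range_succ]
    rw [← ih]
    refine lintegral_mul_eq_lintegral_mul_lintegral_of_independent_measurableSpace
      (Mf := blockSigma (⋃ i ∈ Finset.range n, A i)) (blockSigma_le _) (blockSigma_le _)
      (s.indep_blockSigma fun x hx => ?_) ?_ (hZ n)
    · simp only [Set.mem_iUnion, Finset.mem_range] at hx
      obtain ⟨i, hi, hx⟩ := hx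
      exact hA i n hi x hx
    · exact Finset.measurable_fun_prod _ fun i hi =>
        (hZ i).mono (blockSigma_mono (Set.subset_biUnion_of_mem (u := A) hi)) le_rfl

lemma downlink_injective (k i j m : ℕ) : Function.Injective (GainIdx.downlink k i j m) :=
  fun a b h => by simpa using h

/-- Exponential moment of the service time at the natural scale `1 / (θ + 1)`. -/
lemma lintegral_exp_service_le {e : ℕ → GainIdx} (he : Function.Injective e) :
    ∫⁻ ω, ENNReal.ofReal (Real.exp ((s.theta + 1)⁻¹ * (s.service fun i => ω.1 (e i) : ℕ))) ∂s.law ≤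
      8 := by
  have hθ := s.theta_pos
  set t := (s.theta + 1)⁻¹ with ht
  have ht0 : 0 < t := by positivity
  have ht1 : t ≤ 1 := inv_le_one_of_one_le₀ (by linarith)
  have htθ : t * (s.theta + 1) = 1 := inv_mul_cancel₀ (by linarith)
  have h := s.lintegral_service he (f := fun n => Real.exp (t * n)) (fun n => (Real.exp_pos _).le)
    (((hasSum_poisson_pow s.theta (Real.exp t)).mul_left (Real.exp t)).congr_fun fun n => by
      have : Real.exp (t * (n + 1 : ℕ)) = Real.exp t * Real.exp t ^ n := by
        rw [← Real.exp_nat_mul, ← Real.exp_add]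
        congr 1
        push_cast
        ring
      rw [this]
      ring)
  rw [h, ← Real.exp_add]
  have h1 : Real.exp t - 1 ≤ 2 * t := by
    have := Real.abs_exp_sub_one_le (x := t) (by rwa [abs_of_pos ht0])
    rw [abs_of_pos ht0] at this
    exact (le_abs_self _).trans this
  -- The logarithm of the exponential moment of 1 + Poisson(θ) is at most t + 2θt ≤ 2t(θ+1) = 2; the
  -- bound 8 dominates exp 2.
  have h2 : t + s.theta * (Real.exp t - 1) ≤ 2 := by nlinarith
  have h3 : Real.exp 2 ≤ 8 := by
    have := Real.exp_one_lt_d9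
    have h4 : Real.exp 2 = Real.exp 1 * Real.exp 1 := by rw [← Real.exp_add]; norm_num
    rw [h4]
    nlinarith [Real.exp_pos 1]
  calc ENNReal.ofReal (Real.exp (t + s.theta * (Real.exp t - 1))) ≤ ENNReal.ofReal 8 :=
        ENNReal.ofReal_le_ofReal ((Real.exp_le_exp.2 h2).trans h3)
    _ = 8 := by norm_num

/-- The base 8 is the bound on the exponential moment of one service time. Each block contributes an
independent factor of mean 8p + (1-p). -/
lemma lintegral_pow_arrivalCount (k i j n : ℕ) :
    ∫⁻ ω, (8 : ℝ≥0∞) ^ ((Finset.range n).filter (fun t => ω.2 (.during k i j t) = true)).card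
      ∂s.law = ENNReal.ofReal (1 + 7 * s.p) ^ n := by
  have hp := unitInterval.nonneg s.p
  have hp1 := unitInterval.le_one s.p
  have h1 : ∀ t : ℕ, ∫⁻ ω, (if ω.2 (.during k i j t) = true then (8 : ℝ≥0∞) else 1) ∂s.law =
      ENNReal.ofReal (1 + 7 * s.p) := fun t => by
    rw [lintegral_arrival, show (8 : ℝ≥0∞) = ENNReal.ofReal 8 by norm_num,
      ← ENNReal.ofReal_mul hp, mul_one, ← ENNReal.ofReal_add (by positivity) (by linarith)]
    congr 1
    ring
  have hdisj : ∀ a b : ℕ, a < b → ∀ x : Label, x ∈ ({.inr (.during k i j a)} : Set Label) →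
      x ∉ ({.inr (.during k i j b)} : Set Label) := fun a b hab x hx hy => by
    have := (Set.mem_singleton_iff.1 hx).symm.trans (Set.mem_singleton_iff.1 hy)
    simp only [Sum.inr.injEq, ArrivalIdx.during.injEq, true_and] at this
    omega
  have hmeas : ∀ t : ℕ, Measurable[blockSigma {.inr (.during k i j t)}]
      fun ω : Sample => if ω.2 (.during k i j t) = true then (8 : ℝ≥0∞) else 1 := fun t => by
    have h := measurable_arrival (Set.mem_singleton (.inr (.during k i j t) : Label))
    exact Measurable.ite (h (measurableSet_singleton true)) measurable_const measurable_const
  have h2 := s.lintegral_prod_range_eq hdisj hmeas n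
  rw [Finset.prod_congr rfl fun t _ => h1 t, Finset.prod_const, Finset.card_range] at h2
  rw [← h2]
  refine lintegral_congr fun ω => ?_
  rw [Finset.prod_ite]
  simp

/-- Chernoff bound: a busy period longer than n means that the packets present by block n, one plus
the arrivals, need more than n blocks of service. Given the arrivals, each of these service times
costs a factor at most 8. -/
lemma downBusy_tail (k i j n : ℕ) :
    s.law {ω | n < s.downBusy ω k i j} ≤
      ENNReal.ofReal (8 * (Real.exp (-(s.theta + 1)⁻¹) * (1 + 7 * s.p)) ^ n) := by
  have hp := unitInterval.nonneg s.p
  set t := (s.theta + 1)⁻¹ with ht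
  have ht0 : 0 ≤ t := by have := s.theta_pos; positivity
  set A : Sample → ℕ := fun ω =>
    ((Finset.range n).filter (fun t => ω.2 (.during k i j t) = true)).card with hA
  set S : ℕ → Sample → ℕ := fun m ω => s.service fun n => ω.1 (.downlink k i j m n) with hS
  set g : ℕ → Sample → ℝ≥0∞ := fun N ω =>
    ∏ m ∈ Finset.range (1 + N), ENNReal.ofReal (Real.exp (t * S m ω)) with hg
  have hSm : ∀ m, Measurable[blockSigma {x | ∃ l, x = .inl (.downlink k i j m l)}] fun ω =>
      ENNReal.ofReal (Real.exp (t * S m ω)) := fun m =>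
    (measurable_of_countable fun N : ℕ => ENNReal.ofReal (Real.exp (t * N))).comp
      (s.measurable_service (m := blockSigma _) fun l => measurable_gain ⟨l, rfl⟩)
  have hAm : Measurable[blockSigma {x | kind x = 4}] A :=
    measurable_arrivalCount (m := blockSigma _) (fun _ => measurable_arrival rfl) n
  have hgm : ∀ N, Measurable[blockSigma {x | kind x = 3}] (g N) := fun N =>
    Finset.measurable_fun_prod _ fun m _ => (hSm m).mono (blockSigma_mono fun x hx => by
      obtain ⟨l, rfl⟩ := hx
      rfl) le_rfl
  have hgi : ∀ N, ∫⁻ ω, g N ω ∂s.law ≤ 8 ^ (1 + N) := fun N => by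
    rw [hg, s.lintegral_prod_range_eq (A := fun m => {x | ∃ l, x = .inl (.downlink k i j m l)})
      (fun a b hab x ⟨l, hl⟩ ⟨l', hl'⟩ => by
        have := hl.symm.trans hl'
        simp at this
        omega) hSm]
    simpa using Finset.prod_le_pow_card (Finset.range (1 + N)) _ (8 : ℝ≥0∞) fun m _ =>
      s.lintegral_exp_service_le (downlink_injective k i j m)
  -- If n is below the infimum, it violates the defining condition. An endless busy period has the
  -- default value 0 and is never above n, so finiteness need not be shown.
  have hexp : ∀ ω, n < s.downBusy ω k i j →
      1 ≤ ENNReal.ofReal (Real.exp (-t) ^ n) * g (A ω) ω := fun ω hω => by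
    have h1 : n < ∑ m ∈ Finset.range (1 + A ω), S m ω := by
      by_contra h
      exact Nat.notMem_of_lt_sInf hω (not_lt.1 h)
    rw [hg]
    simp only
    rw [← ENNReal.ofReal_prod_of_nonneg fun m _ => (Real.exp_pos _).le,
      ← ENNReal.ofReal_mul (by positivity), ← ENNReal.ofReal_one]
    refine ENNReal.ofReal_le_ofReal ?_
    rw [← Real.exp_sum, ← Real.exp_nat_mul, ← Real.exp_add, ← Finset.mul_sum]
    refine Real.one_le_exp ?_
    have h2 : (n : ℝ) ≤ ∑ m ∈ Finset.range (1 + A ω), (S m ω : ℝ) := by exact_mod_cast h1.le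
    nlinarith
  have hmeas : MeasurableSet {ω | n < s.downBusy ω k i j} :=
    ((s.downBusy_mem k i j).mono (blockSigma_le _) le_rfl) measurableSet_Ioi
  have hgA : Measurable fun ω => g (A ω) ω :=
    measurable_apply_nat (hAm.mono (blockSigma_le _) le_rfl)
      fun N => (hgm N).mono (blockSigma_le _) le_rfl
  have hA' : Measurable A := hAm.mono (blockSigma_le _) le_rfl
  calc s.law {ω | n < s.downBusy ω k i j}
      = ∫⁻ ω, Set.indicator {ω | n < s.downBusy ω k i j} 1 ω ∂s.law :=
        (lintegral_indicator_one hmeas).symm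
    _ ≤ ∫⁻ ω, ENNReal.ofReal (Real.exp (-t) ^ n) * g (A ω) ω ∂s.law := by
        refine lintegral_mono fun ω => ?_
        by_cases h : n < s.downBusy ω k i j
        · rw [Set.indicator_of_mem (by exact h)]
          exact hexp ω h
        · rw [Set.indicator_of_notMem (by exact h)]
          exact bot_le
    _ = ENNReal.ofReal (Real.exp (-t) ^ n) * ∫⁻ ω, ∫⁻ ω', g (A ω) ω' ∂s.law ∂s.law := by
        rw [lintegral_const_mul _ hgA, lintegral_apply_of_indep (blockSigma_le _) (blockSigma_le _)
          (s.indep_blockSigma fun x h1 h2 => ?_) hAm hgm]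
        have h1 : kind x = 4 := h1
        have h2 : kind x = 3 := h2
        omega
    _ ≤ ENNReal.ofReal (Real.exp (-t) ^ n) * ∫⁻ ω, 8 * 8 ^ A ω ∂s.law := by
        gcongr with ω
        rw [← pow_succ', add_comm]
        exact hgi _
    _ = ENNReal.ofReal (Real.exp (-t) ^ n) * (8 * ENNReal.ofReal (1 + 7 * s.p) ^ n) := by
        have h8 : Measurable fun ω => (8 : ℝ≥0∞) ^ A ω :=
          (measurable_of_countable fun N : ℕ => (8 : ℝ≥0∞) ^ N).comp hA'
        rw [lintegral_const_mul _ h8, s.lintegral_pow_arrivalCount k i j n]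
    _ = _ := by
        rw [← ENNReal.ofReal_pow (by positivity), show (8 : ℝ≥0∞) = ENNReal.ofReal 8 by norm_num,
          ← ENNReal.ofReal_mul (by norm_num), ← ENNReal.ofReal_mul (by positivity)]
        rw [mul_pow]
        congr 1
        ring

/-- The load parameter `(θ + 1) p`. -/
def load : ℝ := (s.theta + 1) * s.p

lemma load_nonneg : 0 ≤ s.load :=
  mul_nonneg (by linarith [s.theta_pos]) (unitInterval.nonneg _)

lemma p_le_load : (s.p : ℝ) ≤ s.load := by
  have := s.theta_pos
  have := unitInterval.nonneg s.p
  unfold load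
  nlinarith

lemma measurable_downBusy_global (k i j : ℕ) : Measurable fun ω => s.downBusy ω k i j :=
  (s.downBusy_mem k i j).mono (blockSigma_le _) le_rfl

lemma lintegral_downBusy_sq_le (h : s.load ≤ 1 / 14) (k i j : ℕ) :
    ∫⁻ ω, (s.downBusy ω k i j : ℝ≥0∞) ^ 2 ∂s.law ≤ ENNReal.ofReal (256 * (s.theta + 1) ^ 2) := by
  have hθ := s.theta_pos
  have hp := unitInterval.nonneg s.p
  set t := (s.theta + 1)⁻¹ with ht
  have ht0 : 0 < t := by positivity
  have ht1 : t ≤ 1 := inv_le_one_of_one_le₀ (by linarith)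
  have htθ : t * (s.theta + 1) = 1 := inv_mul_cancel₀ (by linarith)
  -- This is where 1/14 comes from: arrivals may use up at most half of the decay rate t.
  have hpt : 7 * (s.p : ℝ) ≤ t / 2 := by
    unfold load at h
    have := mul_le_mul_of_nonneg_left h ht0.le
    rw [← mul_assoc, htθ] at this
    linarith
  have hr : Real.exp (-t) * (1 + 7 * s.p) ≤ Real.exp (-(t / 2)) := by
    have h1 : 1 + 7 * (s.p : ℝ) ≤ Real.exp (t / 2) := by
      linarith [Real.add_one_le_exp (t / 2)]
    calc Real.exp (-t) * (1 + 7 * s.p) ≤ Real.exp (-t) * Real.exp (t / 2) := by gcongr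
      _ = Real.exp (-(t / 2)) := by rw [← Real.exp_add]; congr 1; ring
  -- With x = t/2 ≤ 1: exp(-x) ≤ 1/(1+x) ≤ 1 - x/2.
  have hr1 : Real.exp (-(t / 2)) ≤ 1 - t / 4 := by
    have h1 : 1 + t / 2 ≤ Real.exp (t / 2) := by linarith [Real.add_one_le_exp (t / 2)]
    have h2 : Real.exp (-(t / 2)) * Real.exp (t / 2) = 1 := by rw [← Real.exp_add]; simp
    have h3 := Real.exp_pos (-(t / 2))
    nlinarith
  refine (lintegral_natCast_sq_le (s.measurable_downBusy_global k i j) (c := 8)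
    (r := Real.exp (-t) * (1 + 7 * s.p)) (by norm_num) (by positivity) (by linarith)
    (s.downBusy_tail k i j)).trans (ENNReal.ofReal_le_ofReal ?_)
  have h4 : t / 4 ≤ 1 - Real.exp (-t) * (1 + 7 * s.p) := by linarith
  calc 2 * 8 / (1 - Real.exp (-t) * (1 + 7 * s.p)) ^ 2 ≤ 2 * 8 / (t / 4) ^ 2 := by gcongr
    _ = 256 * (s.theta + 1) ^ 2 := by
        rw [ht]
        field_simp
        norm_num

/-- Uses N ≤ c + N²/c, with c = 16(θ+1) balancing the two terms against the second-moment bound. -/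
lemma lintegral_downBusy_le (h : s.load ≤ 1 / 14) (k i j : ℕ) :
    ∫⁻ ω, (s.downBusy ω k i j : ℝ≥0∞) ∂s.law ≤ ENNReal.ofReal (32 * (s.theta + 1)) := by
  have hθ := s.theta_pos
  set c := 16 * (s.theta + 1) with hc
  have hc0 : 0 < c := by positivity
  have hm : Measurable fun ω => (s.downBusy ω k i j : ℝ≥0∞) :=
    measurable_from_top.comp (s.measurable_downBusy_global k i j)
  have hle : ∀ N : ℕ, (N : ℝ≥0∞) ≤ ENNReal.ofReal c + ENNReal.ofReal c⁻¹ * (N : ℝ≥0∞) ^ 2 := by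
    intro N
    rw [← ENNReal.ofReal_natCast, ← ENNReal.ofReal_pow (by positivity),
      ← ENNReal.ofReal_mul (by positivity), ← ENNReal.ofReal_add (by positivity) (by positivity)]
    refine ENNReal.ofReal_le_ofReal ?_
    have h1 : c⁻¹ * c = 1 := inv_mul_cancel₀ hc0.ne'
    have h2 : 0 ≤ c⁻¹ * ((N : ℝ) - c) ^ 2 := by positivity
    have h3 : c⁻¹ * ((N : ℝ) - c) ^ 2 = c⁻¹ * (N : ℝ) ^ 2 - 2 * N * (c⁻¹ * c) + c * (c⁻¹ * c) := by
      ring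
    rw [h3, h1] at h2
    have : (0 : ℝ) ≤ N := by positivity
    linarith
  calc ∫⁻ ω, (s.downBusy ω k i j : ℝ≥0∞) ∂s.law
      ≤ ∫⁻ ω, ENNReal.ofReal c + ENNReal.ofReal c⁻¹ * (s.downBusy ω k i j : ℝ≥0∞) ^ 2 ∂s.law :=
        lintegral_mono fun ω => hle _
    _ = ENNReal.ofReal c + ENNReal.ofReal c⁻¹ * ∫⁻ ω, (s.downBusy ω k i j : ℝ≥0∞) ^ 2 ∂s.law := by
        rw [lintegral_add_left measurable_const, lintegral_const_mul _ (hm.pow_const 2)]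
        simp
    _ ≤ ENNReal.ofReal c + ENNReal.ofReal c⁻¹ * ENNReal.ofReal (256 * (s.theta + 1) ^ 2) := by
        gcongr
        exact s.lintegral_downBusy_sq_le h k i j
    _ = _ := by
        rw [← ENNReal.ofReal_mul (by positivity), ← ENNReal.ofReal_add hc0.le (by positivity)]
        congr 1
        rw [hc]
        field_simp
        norm_num

/-- More than n busy periods require n + 1 successive starts, an event of probability p^(n+1). The
extra factor p makes the moment small and not merely bounded. -/
lemma lintegral_numBusy_sq_le (h : s.load ≤ 1 / 14) (k i : ℕ) :
    ∫⁻ ω, (numBusy ω k i : ℝ≥0∞) ^ 2 ∂s.law ≤ ENNReal.ofReal (8 * s.p) := by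
  have hp := unitInterval.nonneg s.p
  have hp1 := s.p_le_load
  refine (lintegral_natCast_sq_le ((numBusy_mem k i).mono (blockSigma_le _) le_rfl) (c := s.p)
    (r := s.p) hp hp (by linarith) fun n => ?_).trans (ENNReal.ofReal_le_ofReal ?_)
  · have hinj : Function.Injective (ArrivalIdx.start k i) := fun a b h => by simpa using h
    have h1 := s.law_arrivals_true ((Finset.range (n + 1)).map ⟨_, hinj⟩)
    rw [Finset.card_map, Finset.card_range, ← ENNReal.ofReal_pow hp, pow_succ'] at h1
    rw [← h1]
    refine measure_mono fun ω hω => ?_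
    simp only [Finset.mem_map, Finset.mem_range, Function.Embedding.coeFn_mk, Set.mem_ofPred_eq,
      forall_exists_index, and_imp, forall_apply_eq_imp_iff₂]
    intro j hj
    have hω : n < numBusy ω k i := hω
    have : ¬ ω.2 (.start k i j) = false :=
      Nat.notMem_of_lt_sInf (s := {j | ω.2 (.start k i j) = false}) (lt_of_lt_of_le hj hω)
    simpa using this
  · have h2 : (1 / 2 : ℝ) ≤ 1 - s.p := by linarith
    calc 2 * (s.p : ℝ) / (1 - (s.p : ℝ)) ^ 2 ≤ 2 * (s.p : ℝ) / (1 / 2) ^ 2 := by gcongr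
      _ = 8 * (s.p : ℝ) := by ring

lemma lintegral_numBusy_le (h : s.load ≤ 1 / 14) (k i : ℕ) :
    ∫⁻ ω, (numBusy ω k i : ℝ≥0∞) ∂s.law ≤ ENNReal.ofReal (8 * s.p) := by
  refine (lintegral_mono fun ω => ?_).trans (s.lintegral_numBusy_sq_le h k i)
  have h1 : numBusy ω k i ≤ numBusy ω k i ^ 2 := Nat.le_self_pow two_ne_zero _
  have h2 : (numBusy ω k i : ℝ≥0∞) ≤ (numBusy ω k i ^ 2 : ℕ) := Nat.cast_le.2 h1
  rwa [Nat.cast_pow] at h2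

lemma indep_numBusy (k i : ℕ) :
    Indep (blockSigma {x | packet x = k ∧ kind x = 2 ∧ block x = i})
      (blockSigma {x | packet x = k ∧ 3 ≤ kind x ∧ block x = i}) s.law :=
  s.indep_blockSigma fun _ h1 h2 => by
    have := h1.2.1
    have := h2.2.1
    omega

/-- The factor p from the number of busy periods and θ+1 from their length combine into the load. In
the second moment below one factor θ+1 is left over. -/
lemma lintegral_busyDelay_le (h : s.load ≤ 1 / 14) (k i : ℕ) :
    ∫⁻ ω, (s.busyDelay ω k i : ℝ≥0∞) ∂s.law ≤ ENNReal.ofReal (256 * s.load) := by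
  have hθ := s.theta_pos
  have hp := unitInterval.nonneg s.p
  calc ∫⁻ ω, (s.busyDelay ω k i : ℝ≥0∞) ∂s.law
      = ∫⁻ ω, ∑ j ∈ Finset.range (numBusy ω k i), (s.downBusy ω k i j : ℝ≥0∞) ∂s.law :=
        lintegral_congr fun ω => by rw [busyDelay]; push_cast; rfl
    _ ≤ (∫⁻ ω, (numBusy ω k i : ℝ≥0∞) ∂s.law) * ENNReal.ofReal (32 * (s.theta + 1)) :=
        lintegral_random_sum_le (blockSigma_le _) (blockSigma_le _) (s.indep_numBusy k i)
          (numBusy_mem k i) (fun j => measurable_from_top.comp (s.downBusy_mem k i j))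
          (s.lintegral_downBusy_le h k i)
    _ ≤ ENNReal.ofReal (8 * s.p) * ENNReal.ofReal (32 * (s.theta + 1)) := by
        gcongr
        exact s.lintegral_numBusy_le h k i
    _ = _ := by
        rw [← ENNReal.ofReal_mul (by positivity)]
        congr 1
        unfold load
        ring

lemma lintegral_busyDelay_sq_le (h : s.load ≤ 1 / 14) (k i : ℕ) :
    ∫⁻ ω, (s.busyDelay ω k i : ℝ≥0∞) ^ 2 ∂s.law ≤
      ENNReal.ofReal (2048 * s.load * (s.theta + 1)) := by
  have hθ := s.theta_pos
  have hp := unitInterval.nonneg s.p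
  calc ∫⁻ ω, (s.busyDelay ω k i : ℝ≥0∞) ^ 2 ∂s.law
      = ∫⁻ ω, (∑ j ∈ Finset.range (numBusy ω k i), (s.downBusy ω k i j : ℝ≥0∞)) ^ 2 ∂s.law :=
        lintegral_congr fun ω => by rw [busyDelay]; push_cast; rfl
    _ ≤ (∫⁻ ω, (numBusy ω k i : ℝ≥0∞) ^ 2 ∂s.law) * ENNReal.ofReal (256 * (s.theta + 1) ^ 2) :=
        lintegral_random_sum_sq_le_mul (blockSigma_le _) (blockSigma_le _) (s.indep_numBusy k i)
          (numBusy_mem k i) (fun j => measurable_from_top.comp (s.downBusy_mem k i j))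
          (s.lintegral_downBusy_sq_le h k i)
    _ ≤ ENNReal.ofReal (8 * s.p) * ENNReal.ofReal (256 * (s.theta + 1) ^ 2) := by
        gcongr
        exact s.lintegral_numBusy_sq_le h k i
    _ = _ := by
        rw [← ENNReal.ofReal_mul (by positivity)]
        congr 1
        unfold load
        ring

lemma measurable_one_add_busyDelay (k i : ℕ) :
    Measurable[blockSigma {x | packet x = k ∧ 2 ≤ kind x ∧ block x = i}]
      fun ω => ((1 + s.busyDelay ω k i : ℕ) : ℝ≥0∞) :=
  measurable_from_top.comp ((s.busyDelay_mem k i).const_add 1)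

lemma lintegral_one_add_busyDelay_le (h : s.load ≤ 1 / 14) (k i : ℕ) :
    ∫⁻ ω, ((1 + s.busyDelay ω k i : ℕ) : ℝ≥0∞) ∂s.law ≤ ENNReal.ofReal (1 + 256 * s.load) := by
  have hl := s.load_nonneg
  push_cast
  rw [lintegral_add_left measurable_const, ENNReal.ofReal_add zero_le_one (by positivity)]
  gcongr
  · simp
  · exact s.lintegral_busyDelay_le h k i

lemma lintegral_one_add_busyDelay_sq_le (h : s.load ≤ 1 / 14) (k i : ℕ) :
    ∫⁻ ω, ((1 + s.busyDelay ω k i : ℕ) : ℝ≥0∞) ^ 2 ∂s.law ≤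
      ENNReal.ofReal (1 + 2 * (256 * s.load) + 2048 * s.load * (s.theta + 1)) := by
  have hl := s.load_nonneg
  have hθ := s.theta_pos
  have hm : Measurable fun ω => (s.busyDelay ω k i : ℝ≥0∞) :=
    measurable_from_top.comp ((s.busyDelay_mem k i).mono (blockSigma_le _) le_rfl)
  calc ∫⁻ ω, ((1 + s.busyDelay ω k i : ℕ) : ℝ≥0∞) ^ 2 ∂s.law
      = ∫⁻ ω, 1 + 2 * (s.busyDelay ω k i : ℝ≥0∞) + (s.busyDelay ω k i : ℝ≥0∞) ^ 2 ∂s.law :=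
        lintegral_congr fun ω => by push_cast; ring
    _ = 1 + 2 * ∫⁻ ω, (s.busyDelay ω k i : ℝ≥0∞) ∂s.law +
          ∫⁻ ω, (s.busyDelay ω k i : ℝ≥0∞) ^ 2 ∂s.law := by
        rw [lintegral_add_right _ (hm.pow_const 2), lintegral_add_left measurable_const,
          lintegral_const_mul _ hm]
        simp
    _ ≤ 1 + 2 * ENNReal.ofReal (256 * s.load) + ENNReal.ofReal (2048 * s.load * (s.theta + 1)) := by
        gcongr
        · exact s.lintegral_busyDelay_le h k i
        · exact s.lintegral_busyDelay_sq_le h k i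
    _ = _ := by
        rw [ENNReal.ofReal_add (by positivity) (by positivity),
          ENNReal.ofReal_add zero_le_one (by positivity), ENNReal.ofReal_mul zero_le_two]
        simp

lemma indep_upServiceTime (k : ℕ) :
    Indep (blockSigma {x | packet x = k ∧ kind x ≤ 1}) (blockSigma {x | packet x = k ∧ 2 ≤ kind x})
      s.law :=
  s.indep_blockSigma fun _ h1 h2 => by
    have := h1.2
    have := h2.2
    omega

lemma cast_systemTime (ω : Sample) (k : ℕ) : (s.systemTime ω k : ℝ≥0∞) =
    ∑ i ∈ Finset.range (s.upServiceTime ω k), ((1 + s.busyDelay ω k i : ℕ) : ℝ≥0∞) := by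
  rw [systemTime_eq_sum, Nat.cast_sum]

lemma meanUp_pos : 0 < s.meanUp :=
  mul_pos (by linarith [s.theta_pos]) (by linarith [s.one_le_meanIdle])

/-- Absorbs the leftover θ+1 of the delay's second moment. It holds because the idle-block mean is
at least 1 and at most the second moment. -/
lemma meanUp_mul_le_sqUp : s.meanUp * (s.theta + 1) ≤ s.sqUp := by
  have h1 := s.one_le_meanIdle
  have h2 := s.theta_pos
  have h3 : s.meanIdle ≤ s.sqIdle := by
    unfold meanIdle sqIdle
    nlinarith [sq_nonneg s.ratio]
  have h4 : s.meanIdle ≤ s.meanIdle ^ 2 := by nlinarith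
  unfold meanUp sqUp
  have h5 : (s.theta + 1) * s.meanIdle ≤ (s.theta + 1) * s.sqIdle := by gcongr
  have h6 : (s.theta ^ 2 + 2 * s.theta) * s.meanIdle ≤
      (s.theta ^ 2 + 2 * s.theta) * s.meanIdle ^ 2 := by gcongr
  nlinarith [mul_pos h2 (lt_of_lt_of_le one_pos h1)]

lemma sqUp_pos : 0 < s.sqUp :=
  lt_of_lt_of_le (mul_pos s.meanUp_pos (by linarith [s.theta_pos])) s.meanUp_mul_le_sqUp

lemma lintegral_systemTime_le (h : s.load ≤ 1 / 14) (k : ℕ) :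
    ∫⁻ ω, (s.systemTime ω k : ℝ≥0∞) ∂s.law ≤
      ENNReal.ofReal (s.meanUp * (1 + 256 * s.load)) := by
  have h1 := lintegral_random_sum_le (blockSigma_le _) (blockSigma_le _) (s.indep_upServiceTime k)
    (s.upServiceTime_mem k) (fun i => (s.measurable_one_add_busyDelay k i).mono
      (blockSigma_mono fun _ hx => ⟨hx.1, hx.2.1⟩) le_rfl) (s.lintegral_one_add_busyDelay_le h k)
  rw [s.lintegral_upServiceTime, ← ENNReal.ofReal_mul s.meanUp_pos.le] at h1
  simp_rw [cast_systemTime]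
  exact h1

lemma lintegral_systemTime_sq_le (h : s.load ≤ 1 / 14) (k : ℕ) :
    ∫⁻ ω, (s.systemTime ω k : ℝ≥0∞) ^ 2 ∂s.law ≤
      ENNReal.ofReal (s.sqUp * ((1 + 256 * s.load) ^ 2 + 2048 * s.load)) := by
  have hl := s.load_nonneg
  have hM := s.meanUp_pos
  have hQ := s.sqUp_pos
  have hθ := s.theta_pos
  have h1 := lintegral_random_sum_sq_le (blockSigma_le _) (blockSigma_le _)
    (s.indep_upServiceTime k) (s.upServiceTime_mem k)
    (fun i => (s.measurable_one_add_busyDelay k i).mono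
      (blockSigma_mono fun _ hx => ⟨hx.1, hx.2.1⟩) le_rfl)
    (fun i j hij => s.indepFun_of_blockSigma (fun _ hx hy => hij.ne (hx.2.2.symm.trans hy.2.2))
      (s.measurable_one_add_busyDelay k i) (s.measurable_one_add_busyDelay k j))
    (s.lintegral_one_add_busyDelay_le h k) (s.lintegral_one_add_busyDelay_sq_le h k)
  rw [s.lintegral_upServiceTime, s.lintegral_upServiceTime_sq,
    ← ENNReal.ofReal_pow (by positivity), ← ENNReal.ofReal_mul hM.le, ← ENNReal.ofReal_mul hM.le,
    ← ENNReal.ofReal_mul hQ.le, ← ENNReal.ofReal_add (by positivity) (by positivity)] at h1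
  simp_rw [cast_systemTime]
  refine (ENNReal.add_le_add_iff_right ENNReal.ofReal_ne_top).1 (h1.trans ?_)
  rw [← ENNReal.ofReal_add (by positivity) (by positivity)]
  refine ENNReal.ofReal_le_ofReal ?_
  -- For each term 1 + delay, the second-moment bound exceeds the squared mean bound by at most
  -- 2048·load·(θ+1); multiplied by `meanUp` this is at most 2048·load·`sqUp`.
  have h2 := mul_le_mul_of_nonneg_left s.meanUp_mul_le_sqUp hl
  nlinarith [mul_nonneg hM.le (sq_nonneg s.load)]

end System

/-! ### Deterministic renewal theory along one sample path. -/

section Renewal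

/-- Time of the `k`-th renewal. -/
def renewalEpoch (T : ℕ → ℕ) (k : ℕ) : ℕ := ∑ i ∈ Finset.range k, T i

/-- Number of renewals up to time `N`. -/
def renewalCount (T : ℕ → ℕ) (N : ℕ) : ℕ := {k : ℕ | renewalEpoch T (k + 1) ≤ N}.ncard

/-- Age after `n` steps: time since the last renewal but one. -/
def renewalAge (T : ℕ → ℕ) (Δ₀ n : ℕ) : ℝ :=
  ((n + 1 : ℕ) : ℝ) - match renewalCount T n with
    | 0 => -(Δ₀ : ℝ)
    | k + 1 => (renewalEpoch T k : ℝ)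

/-- Accumulated age over one renewal interval. -/
def cycleAge (x y : ℕ) : ℝ := x * y + y * (y + 1) / 2

variable {T : ℕ → ℕ}

lemma renewalEpoch_succ (T : ℕ → ℕ) (k : ℕ) : renewalEpoch T (k + 1) = renewalEpoch T k + T k :=
  Finset.sum_range_succ _ _

lemma renewalEpoch_strictMono (hT : ∀ k, 1 ≤ T k) : StrictMono (renewalEpoch T) :=
  strictMono_nat_of_lt_succ fun k => by
    rw [renewalEpoch_succ]
    have := hT k
    omega

lemma renewalCount_eq (hT : ∀ k, 1 ≤ T k) {m N : ℕ} (h1 : renewalEpoch T m ≤ N)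
    (h2 : N < renewalEpoch T (m + 1)) : renewalCount T N = m := by
  have hmono := (renewalEpoch_strictMono hT).monotone
  have : {k : ℕ | renewalEpoch T (k + 1) ≤ N} = ((Finset.range m : Finset ℕ) : Set ℕ) := by
    ext k
    simp only [Set.mem_ofPred_eq, Finset.coe_range, Set.mem_Iio]
    constructor
    · intro h
      by_contra hk
      have := hmono (show m + 1 ≤ k + 1 by omega)
      omega
    · intro h
      exact (hmono (show k + 1 ≤ m by omega)).trans h1
  rw [renewalCount, this, Set.ncard_coe_finset, Finset.card_range]

lemma renewalCount_spec (hT : ∀ k, 1 ≤ T k) (N : ℕ) :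
    renewalEpoch T (renewalCount T N) ≤ N ∧ N < renewalEpoch T (renewalCount T N + 1) := by
  have hex : ∃ m, N < renewalEpoch T (m + 1) :=
    ⟨N, lt_of_lt_of_le (Nat.lt_succ_self N) ((renewalEpoch_strictMono hT).id_le (N + 1))⟩
  have h2 := Nat.find_spec hex
  have h1 : renewalEpoch T (Nat.find hex) ≤ N := by
    rcases Nat.eq_zero_or_pos (Nat.find hex) with h0 | hpos
    · rw [h0]
      exact Nat.zero_le _
    · have := Nat.find_min hex (Nat.sub_lt hpos one_pos)
      rw [show Nat.find hex - 1 + 1 = Nat.find hex by omega] at this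
      exact not_lt.1 this
  rw [renewalCount_eq hT h1 h2]
  exact ⟨h1, h2⟩

lemma tendsto_renewalCount (hT : ∀ k, 1 ≤ T k) : Tendsto (renewalCount T) atTop atTop := by
  refine tendsto_atTop.2 fun m => ?_
  filter_upwards [eventually_ge_atTop (renewalEpoch T m)] with N hN
  by_contra h
  have h1 := (renewalEpoch_strictMono hT).monotone (show renewalCount T N + 1 ≤ m by omega)
  have h2 := (renewalCount_spec hT N).2
  omega

lemma tendsto_succ_div_natCast : Tendsto (fun k : ℕ => ((k : ℝ) + 1) / k) atTop (𝓝 1) := by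
  have h : Tendsto (fun k : ℕ => 1 + 1 / (k : ℝ)) atTop (𝓝 (1 + 0)) :=
    tendsto_const_nhds.add tendsto_one_div_atTop_nhds_zero_nat
  rw [add_zero] at h
  refine h.congr' ?_
  filter_upwards [eventually_gt_atTop 0] with k hk
  have : (k : ℝ) ≠ 0 := by positivity
  field_simp

/-- Elementary renewal theorem for sequences. -/
lemma tendsto_renewalCount_div (hT : ∀ k, 1 ≤ T k) {μ : ℝ} (hμ : 0 < μ)
    (h : Tendsto (fun k : ℕ => (renewalEpoch T k : ℝ) / k) atTop (𝓝 μ)) :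
    Tendsto (fun N : ℕ => (renewalCount T N : ℝ) / N) atTop (𝓝 (1 / μ)) := by
  have hK := tendsto_renewalCount hT
  have h1 : Tendsto (fun N : ℕ => (renewalEpoch T (renewalCount T N) : ℝ) / renewalCount T N)
      atTop (𝓝 μ) := h.comp hK
  have h2 : Tendsto (fun N : ℕ => (renewalEpoch T (renewalCount T N + 1) : ℝ) /
      ((renewalCount T N + 1 : ℕ) : ℝ) * (((renewalCount T N : ℝ) + 1) / renewalCount T N))
      atTop (𝓝 (μ * 1)) :=
    (h.comp ((tendsto_add_atTop_nat 1).comp hK)).mul (tendsto_succ_div_natCast.comp hK)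
  rw [mul_one] at h2
  -- With K the renewal count, N lies between epochs K and K+1, and both epochs divided by K tend to
  -- μ.
  have h3 : Tendsto (fun N : ℕ => (N : ℝ) / renewalCount T N) atTop (𝓝 μ) := by
    refine tendsto_of_tendsto_of_tendsto_of_le_of_le' h1 h2 ?_ ?_
    · refine Eventually.of_forall fun N => ?_
      have := (renewalCount_spec hT N).1
      change (renewalEpoch T (renewalCount T N) : ℝ) / renewalCount T N ≤ (N : ℝ) / renewalCount T N
      gcongr
    · filter_upwards [hK.eventually_gt_atTop 0] with N hN
      have h4 := (renewalCount_spec hT N).2.le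
      have h5 : (N : ℝ) ≤ renewalEpoch T (renewalCount T N + 1) := by exact_mod_cast h4
      have h6 : (0 : ℝ) < renewalCount T N := by exact_mod_cast hN
      push_cast
      rw [div_mul_div_cancel₀ (by positivity)]
      gcongr
  have h4 := h3.inv₀ hμ.ne'
  simpa using h4

/-- A nondecreasing accumulated reward inherits its rate from the renewal epochs. -/
lemma tendsto_div_of_renewal (hT : ∀ k, 1 ≤ T k) {μ ν : ℝ} (hμ : 0 < μ)
    (h : Tendsto (fun k : ℕ => (renewalEpoch T k : ℝ) / k) atTop (𝓝 μ)) {A : ℕ → ℝ}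
    (hA : Monotone A)
    (hν : Tendsto (fun k : ℕ => A (renewalEpoch T k) / k) atTop (𝓝 ν)) :
    Tendsto (fun N : ℕ => A N / N) atTop (𝓝 (ν / μ)) := by
  have hK := tendsto_renewalCount hT
  have hKN := tendsto_renewalCount_div hT hμ h
  have h1 : Tendsto (fun N : ℕ => A (renewalEpoch T (renewalCount T N)) / renewalCount T N *
      ((renewalCount T N : ℝ) / N)) atTop (𝓝 (ν * (1 / μ))) := (hν.comp hK).mul hKN
  have h2 : Tendsto (fun N : ℕ => A (renewalEpoch T (renewalCount T N + 1)) /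
      ((renewalCount T N + 1 : ℕ) : ℝ) * ((((renewalCount T N : ℝ) + 1) / renewalCount T N) *
      ((renewalCount T N : ℝ) / N))) atTop (𝓝 (ν * (1 * (1 / μ)))) :=
    (hν.comp ((tendsto_add_atTop_nat 1).comp hK)).mul
      ((tendsto_succ_div_natCast.comp hK).mul hKN)
  rw [one_mul, mul_one_div] at h2
  rw [mul_one_div] at h1
  refine tendsto_of_tendsto_of_tendsto_of_le_of_le' h1 h2 ?_ ?_
  · filter_upwards [hK.eventually_gt_atTop 0] with N hN
    have h6 : (0 : ℝ) < renewalCount T N := by exact_mod_cast hN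
    rw [div_mul_div_cancel₀ h6.ne']
    have := hA (renewalCount_spec hT N).1
    gcongr
  · filter_upwards [hK.eventually_gt_atTop 0] with N hN
    have h6 : (0 : ℝ) < renewalCount T N := by exact_mod_cast hN
    rw [div_mul_div_cancel₀ h6.ne']
    push_cast
    rw [div_mul_div_cancel₀ (by positivity)]
    have := hA (renewalCount_spec hT N).2.le
    gcongr

lemma renewalAge_nonneg (hT : ∀ k, 1 ≤ T k) (Δ₀ n : ℕ) : 0 ≤ renewalAge T Δ₀ n := by
  unfold renewalAge
  have h := (renewalCount_spec hT n).1
  split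
  · rw [sub_neg_eq_add]
    positivity
  · rename_i k hk
    rw [hk] at h
    have h1 := (renewalEpoch_strictMono hT (Nat.lt_succ_self k)).le
    have h2 : renewalEpoch T k ≤ n + 1 := by
      have : renewalEpoch T k.succ = renewalEpoch T (k + 1) := rfl
      omega
    have : (renewalEpoch T k : ℝ) ≤ ((n + 1 : ℕ) : ℝ) := by exact_mod_cast h2
    linarith

lemma sum_range_add_cast (a : ℝ) (y : ℕ) :
    ∑ t ∈ Finset.range y, (a + t + 1) = a * y + y * (y + 1) / 2 := by
  induction y with
  | zero => simp
  | succ y ih =>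
    rw [Finset.sum_range_succ, ih]
    push_cast
    ring

/-- After the departure of packet c the freshest generation time stays at epoch c, so t further
steps give age `T c + t + 1` until the next departure. -/
lemma sum_renewalAge_cycle (hT : ∀ k, 1 ≤ T k) (Δ₀ c : ℕ) :
    ∑ n ∈ Finset.range (renewalEpoch T (c + 2)), renewalAge T Δ₀ n =
      ∑ n ∈ Finset.range (renewalEpoch T (c + 1)), renewalAge T Δ₀ n +
        cycleAge (T c) (T (c + 1)) := by
  rw [renewalEpoch_succ T (c + 1), Finset.sum_range_add, cycleAge, ← sum_range_add_cast]
  congr 1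
  refine Finset.sum_congr rfl fun t ht => ?_
  have h1 : renewalCount T (renewalEpoch T (c + 1) + t) = c + 1 :=
    renewalCount_eq hT (Nat.le_add_right _ _) (by
      rw [renewalEpoch_succ T (c + 1)]
      have := Finset.mem_range.1 ht
      omega)
  unfold renewalAge
  rw [h1]
  simp only [renewalEpoch_succ T c]
  push_cast
  ring

lemma sum_renewalAge (hT : ∀ k, 1 ≤ T k) (Δ₀ c : ℕ) :
    ∑ n ∈ Finset.range (renewalEpoch T (c + 1)), renewalAge T Δ₀ n =
      ∑ n ∈ Finset.range (renewalEpoch T 1), renewalAge T Δ₀ n +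
        ∑ k ∈ Finset.range c, cycleAge (T k) (T (k + 1)) := by
  induction c with
  | zero => simp
  | succ c ih => rw [sum_renewalAge_cycle hT, ih, Finset.sum_range_succ, add_assoc]

/-- Renewal–reward with the accumulated age as reward. The stretch before the first departure, which
alone sees the initial age, adds a constant that vanishes on averaging. -/
lemma tendsto_average_renewalAge (hT : ∀ k, 1 ≤ T k) {μ ν : ℝ} (hμ : 0 < μ)
    (h : Tendsto (fun k : ℕ => (renewalEpoch T k : ℝ) / k) atTop (𝓝 μ))
    (hν : Tendsto (fun k : ℕ => (∑ i ∈ Finset.range k, cycleAge (T i) (T (i + 1))) / k)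
      atTop (𝓝 ν)) (Δ₀ : ℕ) :
    Tendsto (fun N : ℕ => (∑ n ∈ Finset.range N, renewalAge T Δ₀ n) / N) atTop (𝓝 (ν / μ)) := by
  refine tendsto_div_of_renewal hT hμ h (A := fun N => ∑ n ∈ Finset.range N, renewalAge T Δ₀ n)
    (monotone_nat_of_le_succ fun n => ?_) ?_
  · rw [Finset.sum_range_succ]
    linarith [renewalAge_nonneg hT Δ₀ n]
  · rw [← tendsto_add_atTop_iff_nat 1]
    set C := ∑ n ∈ Finset.range (renewalEpoch T 1), renewalAge T Δ₀ n with hC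
    have h1 : Tendsto (fun k : ℕ => (C * (1 / (k : ℝ)) +
        (∑ i ∈ Finset.range k, cycleAge (T i) (T (i + 1))) / k) * (((k : ℝ) + 1) / k)⁻¹)
        atTop (𝓝 ((C * 0 + ν) * 1⁻¹)) :=
      ((tendsto_one_div_atTop_nhds_zero_nat.const_mul C).add hν).mul
        (tendsto_succ_div_natCast.inv₀ one_ne_zero)
    rw [mul_zero, zero_add, inv_one, mul_one] at h1
    refine h1.congr' ?_
    filter_upwards [eventually_gt_atTop 0] with k hk
    rw [sum_renewalAge hT]
    have : (k : ℝ) ≠ 0 := by positivity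
    have : (k : ℝ) + 1 ≠ 0 := by positivity
    push_cast
    field_simp
    rw [hC]

end Renewal

/-! ### Strong law for one-dependent sequences. -/

section LawOfLargeNumbers

lemma tendsto_half_div {f : ℕ → ℕ} (h1 : ∀ n, n ≤ 2 * f n) (h2 : ∀ n, 2 * f n ≤ n + 1) :
    Tendsto (fun n : ℕ => (f n : ℝ) / n) atTop (𝓝 (1 / 2)) := by
  have h3 : Tendsto (fun n : ℕ => 1 / 2 * (((n : ℝ) + 1) / n)) atTop (𝓝 (1 / 2 * 1)) :=
    tendsto_succ_div_natCast.const_mul _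
  rw [mul_one] at h3
  refine tendsto_of_tendsto_of_tendsto_of_le_of_le' tendsto_const_nhds h3 ?_ ?_
  · filter_upwards [eventually_gt_atTop 0] with n hn
    have : (n : ℝ) ≤ 2 * f n := by exact_mod_cast h1 n
    rw [le_div_iff₀ (by positivity)]
    linarith
  · filter_upwards [eventually_gt_atTop 0] with n hn
    have : 2 * (f n : ℝ) ≤ n + 1 := by exact_mod_cast h2 n
    rw [← mul_div_assoc]
    gcongr
    linarith

lemma sum_range_even_odd (x : ℕ → ℝ) (n : ℕ) :
    ∑ k ∈ Finset.range n, x k = ∑ j ∈ Finset.range ((n + 1) / 2), x (2 * j) +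
      ∑ j ∈ Finset.range (n / 2), x (2 * j + 1) := by
  induction n with
  | zero => simp
  | succ n ih =>
    rw [Finset.sum_range_succ, ih]
    rcases Nat.even_or_odd' n with ⟨m, rfl | rfl⟩
    · rw [show (2 * m + 1) / 2 = m by omega, show 2 * m / 2 = m by omega,
        show (2 * m + 1 + 1) / 2 = m + 1 by omega, Finset.sum_range_succ]
      ring
    · rw [show (2 * m + 1) / 2 = m by omega, show (2 * m + 1 + 1) / 2 = m + 1 by omega,
        show (2 * m + 1 + 1 + 1) / 2 = m + 1 by omega,
        Finset.sum_range_succ (fun j => x (2 * j + 1))]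
      ring

variable {Ω : Type*} {mΩ : MeasurableSpace Ω} {μ : Measure Ω}

/-- Strong law of large numbers for identically distributed one-dependent variables. -/
lemma strong_law_one_dependent {X : ℕ → Ω → ℝ} (hint : Integrable (X 0) μ)
    (hindep : ∀ i j, i + 2 ≤ j → IndepFun (X i) (X j) μ)
    (hident : ∀ i, IdentDistrib (X i) (X 0) μ μ) :
    ∀ᵐ ω ∂μ, Tendsto (fun n : ℕ => (∑ k ∈ Finset.range n, X k ω) / n) atTop (𝓝 (∫ ω, X 0 ω ∂μ)) := by
  -- Distinct indices of equal parity differ by at least 2, so each parity class is pairwise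
  -- independent, which suffices for the strong law. Each class supplies half of the terms.
  have hpair : ∀ a : ℕ, Pairwise (Function.onFun (fun f g => IndepFun f g μ)
      fun j => X (2 * j + a)) := fun a i j hij => by
    rcases lt_or_gt_of_ne hij with h | h
    · exact hindep _ _ (by omega)
    · exact (hindep _ _ (by omega)).symm
  have hlim : ∀ a : ℕ, ∀ᵐ ω ∂μ, Tendsto (fun n : ℕ =>
      (∑ j ∈ Finset.range n, X (2 * j + a) ω) / n) atTop (𝓝 (∫ ω, X 0 ω ∂μ)) := fun a => by
    have h := strong_law_ae_real (fun j => X (2 * j + a)) ((hident _).integrable_iff.2 hint)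
      (hpair a) (fun i => (hident _).trans (hident _).symm)
    rwa [(hident _).integral_eq] at h
  filter_upwards [hlim 0, hlim 1] with ω h0 h1
  have hdiv : ∀ {f : ℕ → ℕ}, Tendsto f atTop atTop →
      Tendsto (fun n : ℕ => (f n : ℝ) / n) atTop (𝓝 (1 / 2)) → ∀ a : ℕ, Tendsto (fun n : ℕ =>
      (∑ j ∈ Finset.range n, X (2 * j + a) ω) / n) atTop (𝓝 (∫ ω, X 0 ω ∂μ)) →
      Tendsto (fun n : ℕ => (∑ j ∈ Finset.range (f n), X (2 * j + a) ω) / n) atTop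
        (𝓝 ((∫ ω, X 0 ω ∂μ) * (1 / 2))) := fun {f} hf hf2 a ha => by
    refine ((ha.comp hf).mul hf2).congr' ?_
    filter_upwards [hf.eventually_gt_atTop 0] with n hn
    have : (f n : ℝ) ≠ 0 := by exact_mod_cast hn.ne'
    exact div_mul_div_cancel₀ this
  have ht : ∀ b : ℕ, Tendsto (fun n : ℕ => (n + b) / 2) atTop atTop := fun b =>
    (Nat.tendsto_div_const_atTop two_ne_zero).comp (tendsto_add_atTop_nat b)
  have e0 := hdiv (ht 1) (tendsto_half_div (fun n => by omega) fun n => by omega) 0 h0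
  have hodd : Tendsto (fun n : ℕ => ((n / 2 : ℕ) : ℝ) / n) atTop (𝓝 (1 / 2)) := by
    have h2 := (tendsto_half_div (f := fun n => (n + 1) / 2) (fun n => by omega)
      fun n => by omega).const_sub 1
    rw [sub_half] at h2
    refine h2.congr' ?_
    filter_upwards [eventually_gt_atTop 0] with n hn
    have : (n : ℝ) ≠ 0 := by positivity
    have h3 : (((n + 1) / 2 : ℕ) : ℝ) + ((n / 2 : ℕ) : ℝ) = n := by
      exact_mod_cast (by omega : (n + 1) / 2 + n / 2 = n)
    rw [eq_div_iff this, sub_mul, div_mul_cancel₀ _ this]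
    linarith
  have e1 := hdiv (ht 0) hodd 1 h1
  have e2 := e0.add e1
  rw [← mul_add, add_halves, mul_one] at e2
  refine e2.congr fun n => ?_
  rw [sum_range_even_odd (fun k => X k ω) n, add_div]
  rfl

end LawOfLargeNumbers

/-! ### Stationarity over packets and almost sure limits. -/

/-- Shift of the uplink packets by `k`. -/
def shiftGain (k : ℕ) : GainIdx → GainIdx
  | .uplink l i => .uplink (l + k) i
  | .harvest l i j => .harvest (l + k) i j
  | .downlink l i j m n => .downlink (l + k) i j m n

/-- Shift of the uplink packets by `k`. -/
def shiftArrival (k : ℕ) : ArrivalIdx → ArrivalIdx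
  | .start l i j => .start (l + k) i j
  | .during l i j n => .during (l + k) i j n

lemma shiftGain_injective (k : ℕ) : Function.Injective (shiftGain k) := by
  rintro (_ | _ | _) (_ | _ | _) h <;> simp_all [shiftGain]

lemma shiftArrival_injective (k : ℕ) : Function.Injective (shiftArrival k) := by
  rintro (_ | _) (_ | _) h <;> simp_all [shiftArrival]

/-- The sample seen from uplink packet `k` on. -/
def shiftSample (k : ℕ) (ω : Sample) : Sample :=
  (fun g => ω.1 (shiftGain k g), fun a => ω.2 (shiftArrival k a))

namespace System

variable (s : System)

lemma measurePreserving_shiftSample (k : ℕ) :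
    MeasurePreserving (shiftSample k) s.law s.law :=
  s.measurePreserving_relabel (shiftGain_injective k) (shiftArrival_injective k)

/-- With invariance of the law under the shift, this gives identical distribution jointly for
several packets, as needed for `packetAge`. -/
lemma systemTime_shiftSample (k l : ℕ) (ω : Sample) :
    s.systemTime (shiftSample k ω) l = s.systemTime ω (l + k) := rfl

lemma identDistrib_shiftSample {f : Sample → ℝ} (hf : Measurable f) (k : ℕ) :
    IdentDistrib (fun ω => f (shiftSample k ω)) f s.law s.law where
  aemeasurable_fst := (hf.comp (s.measurePreserving_shiftSample k).measurable).aemeasurable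
  aemeasurable_snd := hf.aemeasurable
  map_eq := by
    conv_rhs => rw [← (s.measurePreserving_shiftSample k).map_eq,
      Measure.map_map hf (s.measurePreserving_shiftSample k).measurable]
    rfl

lemma measurable_cast_systemTime (k : ℕ) : Measurable fun ω => (s.systemTime ω k : ℝ) :=
  measurable_from_top.comp (s.measurable_systemTime k)

lemma identDistrib_systemTime (k : ℕ) : IdentDistrib (fun ω => (s.systemTime ω k : ℝ))
    (fun ω => (s.systemTime ω 0 : ℝ)) s.law s.law := by
  have h := s.identDistrib_shiftSample (s.measurable_cast_systemTime 0) k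
  simpa only [systemTime_shiftSample, zero_add] using h

lemma ae_one_le_systemTime : ∀ᵐ ω ∂s.law, ∀ k, 1 ≤ s.systemTime ω k := by
  rw [ae_all_iff]
  intro k
  filter_upwards [s.ae_one_le_upServiceTime k] with ω hω
  exact hω.trans (s.upServiceTime_le_systemTime ω k)

/-- Mean system time. -/
def meanTime : ℝ := ∫ ω, (s.systemTime ω 0 : ℝ) ∂s.law

/-- Second moment of the system time. -/
def sqTime : ℝ := ∫ ω, (s.systemTime ω 0 : ℝ) ^ 2 ∂s.law

lemma meanTime_eq : s.meanTime = (∫⁻ ω, (s.systemTime ω 0 : ℝ≥0∞) ∂s.law).toReal := by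
  rw [meanTime, integral_eq_lintegral_of_nonneg_ae (ae_of_all _ fun ω => Nat.cast_nonneg _)
    (s.measurable_cast_systemTime 0).aestronglyMeasurable]
  simp

lemma sqTime_eq : s.sqTime = (∫⁻ ω, (s.systemTime ω 0 : ℝ≥0∞) ^ 2 ∂s.law).toReal := by
  rw [sqTime, integral_eq_lintegral_of_nonneg_ae (ae_of_all _ fun ω => by positivity)
    ((s.measurable_cast_systemTime 0).pow_const 2).aestronglyMeasurable]
  simp only [ENNReal.ofReal_pow (Nat.cast_nonneg _), ENNReal.ofReal_natCast]

section Light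

variable {s}

lemma meanTime_le (h : s.load ≤ 1 / 14) : s.meanTime ≤ s.meanUp * (1 + 256 * s.load) := by
  have := s.load_nonneg
  have := s.meanUp_pos
  rw [meanTime_eq]
  exact ENNReal.toReal_le_of_le_ofReal (by positivity) (s.lintegral_systemTime_le h 0)

lemma meanUp_le (h : s.load ≤ 1 / 14) : s.meanUp ≤ s.meanTime := by
  rw [meanTime_eq, ← ENNReal.ofReal_le_iff_le_toReal
    (ne_top_of_le_ne_top ENNReal.ofReal_ne_top (s.lintegral_systemTime_le h 0)),
    ← s.lintegral_upServiceTime 0]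
  exact lintegral_mono fun ω => Nat.cast_le.2 (s.upServiceTime_le_systemTime ω 0)

lemma sqTime_le (h : s.load ≤ 1 / 14) :
    s.sqTime ≤ s.sqUp * ((1 + 256 * s.load) ^ 2 + 2048 * s.load) := by
  have := s.load_nonneg
  have := s.sqUp_pos
  rw [sqTime_eq]
  exact ENNReal.toReal_le_of_le_ofReal (by positivity) (s.lintegral_systemTime_sq_le h 0)

lemma sqUp_le (h : s.load ≤ 1 / 14) : s.sqUp ≤ s.sqTime := by
  rw [sqTime_eq, ← ENNReal.ofReal_le_iff_le_toReal
    (ne_top_of_le_ne_top ENNReal.ofReal_ne_top (s.lintegral_systemTime_sq_le h 0)),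
    ← s.lintegral_upServiceTime_sq 0]
  exact lintegral_mono fun ω =>
    pow_le_pow_left' (Nat.cast_le.2 (s.upServiceTime_le_systemTime ω 0)) 2

lemma integrable_systemTime (h : s.load ≤ 1 / 14) (k : ℕ) :
    Integrable (fun ω => (s.systemTime ω k : ℝ)) s.law := by
  refine ⟨(s.measurable_cast_systemTime k).aestronglyMeasurable, ?_⟩
  rw [hasFiniteIntegral_iff_ofReal (ae_of_all _ fun ω => Nat.cast_nonneg _)]
  simp only [ENNReal.ofReal_natCast]
  exact (s.lintegral_systemTime_le h k).trans_lt ENNReal.ofReal_lt_top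

lemma integrable_systemTime_sq (h : s.load ≤ 1 / 14) (k : ℕ) :
    Integrable (fun ω => (s.systemTime ω k : ℝ) ^ 2) s.law := by
  refine ⟨((s.measurable_cast_systemTime k).pow_const 2).aestronglyMeasurable, ?_⟩
  rw [hasFiniteIntegral_iff_ofReal (ae_of_all _ fun ω => by positivity)]
  simp only [ENNReal.ofReal_pow (Nat.cast_nonneg _), ENNReal.ofReal_natCast]
  exact (s.lintegral_systemTime_sq_le h k).trans_lt ENNReal.ofReal_lt_top

lemma indepFun_systemTime (k l : ℕ) (hkl : k ≠ l) :
    IndepFun (fun ω => (s.systemTime ω k : ℝ)) (fun ω => (s.systemTime ω l : ℝ)) s.law :=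
  s.indepFun_of_blockSigma (fun _ hx hy => hkl (hx.symm.trans hy))
    (measurable_from_top.comp (s.systemTime_mem k)) (measurable_from_top.comp (s.systemTime_mem l))

lemma ae_tendsto_genEpoch (h : s.load ≤ 1 / 14) :
    ∀ᵐ ω ∂s.law, Tendsto (fun k : ℕ => (s.genEpoch ω k : ℝ) / k) atTop (𝓝 s.meanTime) := by
  filter_upwards [strong_law_ae_real (fun k ω => (s.systemTime ω k : ℝ))
    (integrable_systemTime h 0) (fun k l hkl => indepFun_systemTime k l hkl)
    s.identDistrib_systemTime] with ω hω
  simpa only [genEpoch, Nat.cast_sum] using! hω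

lemma measurable_cycleAge {Ω : Type*} {m : MeasurableSpace Ω} {X Y : Ω → ℕ} (hX : Measurable X)
    (hY : Measurable Y) : Measurable fun ω => cycleAge (X ω) (Y ω) :=
  (measurable_of_countable fun q : ℕ × ℕ => cycleAge q.1 q.2).comp (hX.prodMk hY)

/-- The age accumulated between the departures of packets `k` and `k + 1`. -/
def packetAge (s : System) (k : ℕ) (ω : Sample) : ℝ :=
  cycleAge (s.systemTime ω k) (s.systemTime ω (k + 1))

lemma packetAge_mem (k : ℕ) :
    Measurable[blockSigma {x | packet x = k ∨ packet x = k + 1}] (s.packetAge k) := by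
  have h1 := (s.systemTime_mem k).mono (blockSigma_mono (B := {x | packet x = k ∨ packet x = k + 1})
    fun x hx => Or.inl hx) le_rfl
  have h2 := (s.systemTime_mem (k + 1)).mono
    (blockSigma_mono (B := {x | packet x = k ∨ packet x = k + 1}) fun x hx => Or.inr hx) le_rfl
  exact measurable_cycleAge (m := blockSigma _) h1 h2

lemma integrable_packetAge (h : s.load ≤ 1 / 14) : Integrable (s.packetAge 0) s.law := by
  have h1 := (indepFun_systemTime (s := s) 0 1 zero_ne_one).integrable_mul
    (integrable_systemTime h 0) (integrable_systemTime h 1)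
  have h2 := ((integrable_systemTime_sq h 1).add (integrable_systemTime h 1)).div_const 2
  refine (h1.add h2).congr (ae_of_all _ fun ω => ?_)
  simp only [Pi.add_apply, Pi.mul_apply, packetAge, cycleAge, zero_add]
  ring

lemma integral_packetAge (h : s.load ≤ 1 / 14) :
    ∫ ω, s.packetAge 0 ω ∂s.law = s.meanTime ^ 2 + (s.sqTime + s.meanTime) / 2 := by
  have hind := indepFun_systemTime (s := s) 0 1 zero_ne_one
  have h1 := hind.integrable_mul (integrable_systemTime h 0) (integrable_systemTime h 1)
  have h2 := (integrable_systemTime_sq h 1).add (integrable_systemTime h 1)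
  have e1 : ∫ ω, (s.systemTime ω 1 : ℝ) ∂s.law = s.meanTime :=
    (s.identDistrib_systemTime 1).integral_eq
  have e2 : ∫ ω, (s.systemTime ω 1 : ℝ) ^ 2 ∂s.law = s.sqTime :=
    ((s.identDistrib_systemTime 1).comp (measurable_id.pow_const 2)).integral_eq
  have e3 : ∫ ω, (s.systemTime ω 0 : ℝ) * (s.systemTime ω 1 : ℝ) ∂s.law =
      s.meanTime * s.meanTime := by
    have := hind.integral_mul_eq_mul_integral
      (s.measurable_cast_systemTime 0).aestronglyMeasurable
      (s.measurable_cast_systemTime 1).aestronglyMeasurable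
    rw [e1] at this
    exact this
  calc ∫ ω, s.packetAge 0 ω ∂s.law
      = ∫ ω, ((s.systemTime ω 0 : ℝ) * (s.systemTime ω 1 : ℝ) +
          ((s.systemTime ω 1 : ℝ) ^ 2 + (s.systemTime ω 1 : ℝ)) / 2) ∂s.law := by
        refine integral_congr_ae (ae_of_all _ fun ω => ?_)
        simp only [packetAge, cycleAge, zero_add]
        ring
    _ = s.meanTime * s.meanTime + (s.sqTime + s.meanTime) / 2 := by
        have e4 := integral_add h1 (h2.div_const 2)
        simp only [Pi.mul_apply, Pi.add_apply] at e4
        rw [e4, integral_div, integral_add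
          (integrable_systemTime_sq h 1) (integrable_systemTime h 1), e1, e2, e3]
    _ = _ := by ring

/-- Accumulated ages of consecutive cycles share a packet and are dependent; cycles at least two
apart use disjoint labels. -/
lemma ae_tendsto_packetAge (h : s.load ≤ 1 / 14) :
    ∀ᵐ ω ∂s.law, Tendsto (fun k : ℕ => (∑ i ∈ Finset.range k, s.packetAge i ω) / k) atTop
      (𝓝 (s.meanTime ^ 2 + (s.sqTime + s.meanTime) / 2)) := by
  rw [← integral_packetAge h]
  refine strong_law_one_dependent (integrable_packetAge h) (fun i j hij =>
    s.indepFun_of_blockSigma (fun x hx hy => ?_) (packetAge_mem i) (packetAge_mem j)) fun k => ?_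
  · have hx : packet x = i ∨ packet x = i + 1 := hx
    have hy : packet x = j ∨ packet x = j + 1 := hy
    omega
  · have h1 := s.identDistrib_shiftSample ((packetAge_mem (s := s) 0).mono (blockSigma_le _) le_rfl) k
    have h2 : (fun ω => s.packetAge 0 (shiftSample k ω)) = s.packetAge k := by
      funext ω
      simp only [packetAge, systemTime_shiftSample, zero_add, add_comm 1 k]
    rwa [h2] at h1

lemma meanTime_pos (h : s.load ≤ 1 / 14) : 0 < s.meanTime :=
  s.meanUp_pos.trans_le (meanUp_le h)

lemma delivered_eq (s : System) (ω : Sample) (N : ℕ) :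
    s.delivered ω N = renewalCount (s.systemTime ω) N := by
  unfold delivered renewalCount
  congr 1
  ext k
  simp only [Set.mem_ofPred_eq, renewalEpoch_succ]
  rfl

/-- Blocks are counted from 1 and steps from 0: a departure before block n + 1 is one by time n. -/
lemma age_succ_eq (s : System) (ω : Sample) (Δ₀ n : ℕ) :
    s.age ω Δ₀ (n + 1) = renewalAge (s.systemTime ω) Δ₀ n := by
  have h1 : {k : ℕ | s.depEpoch ω k < n + 1}.ncard = renewalCount (s.systemTime ω) n := by
    rw [← delivered_eq]
    unfold delivered
    congr 1
    ext k
    simp only [Set.mem_ofPred_eq, Nat.lt_succ_iff]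
  unfold age latestGen renewalAge
  rw [h1]
  rfl

/-- The uplink data rate is the reciprocal of the mean system time. -/
theorem hasUplinkRate (h : s.load ≤ 1 / 14) : s.HasUplinkRate (1 / s.meanTime) := by
  filter_upwards [s.ae_one_le_systemTime, ae_tendsto_genEpoch h] with ω hT hG
  simp_rw [delivered_eq]
  exact tendsto_renewalCount_div hT (meanTime_pos h) hG

/-- The average uplink age of information in terms of two moments of the system time. -/
theorem hasAverageAoI (h : s.load ≤ 1 / 14) :
    s.HasAverageAoI (s.meanTime + s.sqTime / (2 * s.meanTime) + 1 / 2) := by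
  intro Δ₀
  filter_upwards [s.ae_one_le_systemTime, ae_tendsto_genEpoch h, ae_tendsto_packetAge h]
    with ω hT hG hW
  have hpos := meanTime_pos h
  have h1 := tendsto_average_renewalAge hT hpos hG hW Δ₀
  have e : (s.meanTime ^ 2 + (s.sqTime + s.meanTime) / 2) / s.meanTime =
      s.meanTime + s.sqTime / (2 * s.meanTime) + 1 / 2 := by
    field_simp
    ring
  rw [e] at h1
  refine h1.congr fun N => ?_
  rw [one_div, inv_mul_eq_div, Finset.range_eq_Ico,
    Finset.sum_congr rfl fun n _ => (s.age_succ_eq ω Δ₀ n).symm,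
    Finset.sum_Ico_add' (fun n => s.age ω Δ₀ n) 0 N 1]
  rfl

end Light

lemma lightRate_eq : lightRate s.ratio s.theta = 1 / s.meanUp := by
  unfold lightRate meanUp meanIdle
  rw [mul_comm, add_comm 1]

/-- The limiting constant is the renewal formula for the average age with S_UL in place of T. -/
lemma lightAoI_eq :
    lightAoI s.ratio s.theta = s.meanUp + s.sqUp / (2 * s.meanUp) + 1 / 2 := by
  have h1 : 0 < s.meanIdle := lt_of_lt_of_le one_pos s.one_le_meanIdle
  have h2 := s.theta_pos
  have h3 : 0 < s.theta + 1 := by linarith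
  have h4 : 0 < 1 + s.theta := by linarith
  have e : lightAoI s.ratio s.theta = 1 / 2 * (s.sqIdle / s.meanIdle +
      s.meanIdle * (3 * s.theta ^ 2 + 6 * s.theta + 2) / (1 + s.theta)) + 1 / 2 := rfl
  rw [e, meanUp, sqUp]
  field_simp
  ring

end System

/-! ### Relative errors and the final limits. -/

lemma tendsto_div_of_relative_bounds {ι : Type*} {l : Filter ι} {x y c : ι → ℝ}
    (hc : Tendsto c l (𝓝 1)) (hy : ∀ i, 0 < y i) (h1 : ∀ᶠ i in l, y i ≤ x i)
    (h2 : ∀ᶠ i in l, x i ≤ y i * c i) : Tendsto (fun i => x i / y i) l (𝓝 1) := by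
  refine tendsto_of_tendsto_of_tendsto_of_le_of_le' tendsto_const_nhds hc ?_ ?_
  · filter_upwards [h1] with i hi
    exact (one_le_div (hy i)).2 hi
  · filter_upwards [h2] with i hi
    rw [div_le_iff₀ (hy i), mul_comm]
    exact hi

end

theorem corollary1 {ι : Type*} (l : Filter ι) (sys : ι → System)
    (hlight : Tendsto (fun i => ((sys i).theta + 1) * ((sys i).p : ℝ)) l (𝓝 0)) :
    ∃ D q : ι → ℝ,
      -- the average uplink age of information and the uplink data rate exist
      (∀ᶠ i in l, (sys i).HasAverageAoI (D i) ∧ (sys i).HasUplinkRate (q i)) ∧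
      -- for fixed `λ / η` and `θ` they tend to the stated constants
      (∀ a θ : ℝ, (∀ i, (sys i).ratio = a ∧ (sys i).theta = θ) →
        Tendsto D l (𝓝 (lightAoI a θ)) ∧ Tendsto q l (𝓝 (lightRate a θ))) ∧
      -- if `λ / η` and `θ` vary as well, the same holds in the sense of relative error
      Tendsto (fun i => D i / lightAoI (sys i).ratio (sys i).theta) l (𝓝 1) ∧
      Tendsto (fun i => q i / lightRate (sys i).ratio (sys i).theta) l (𝓝 1) := by
  -- Defined for every index, but shown to be the average age only once the load is at most 1/14,
  -- which holds eventually.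
  set D : ι → ℝ := fun i =>
    (sys i).meanTime + (sys i).sqTime / (2 * (sys i).meanTime) + 1 / 2 with hD
  set q : ι → ℝ := fun i => 1 / (sys i).meanTime with hq
  have hload : Tendsto (fun i => (sys i).load) l (𝓝 0) := hlight
  have hsmall : ∀ᶠ i in l, (sys i).load ≤ 1 / 14 := hload.eventually_le_const (by norm_num)
  have hM : ∀ i, 0 < (sys i).meanUp := fun i => (sys i).meanUp_pos
  have hQ : ∀ i, 0 < (sys i).sqUp := fun i => (sys i).sqUp_pos
  have hmean : Tendsto (fun i => (sys i).meanTime / (sys i).meanUp) l (𝓝 1) := by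
    refine tendsto_div_of_relative_bounds (c := fun i => 1 + 256 * (sys i).load) ?_ hM
      (hsmall.mono fun i hi => System.meanUp_le hi) (hsmall.mono fun i hi => System.meanTime_le hi)
    simpa using (hload.const_mul 256).const_add 1
  have hsq : Tendsto (fun i => (sys i).sqTime / (sys i).sqUp) l (𝓝 1) := by
    refine tendsto_div_of_relative_bounds
      (c := fun i => (1 + 256 * (sys i).load) ^ 2 + 2048 * (sys i).load) ?_ hQ
      (hsmall.mono fun i hi => System.sqUp_le hi) (hsmall.mono fun i hi => System.sqTime_le hi)
    simpa using (((hload.const_mul 256).const_add 1).pow 2).add (hload.const_mul 2048)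
  have hrate : Tendsto (fun i => q i / lightRate (sys i).ratio (sys i).theta) l (𝓝 1) := by
    have h := hmean.inv₀ one_ne_zero
    rw [inv_one] at h
    refine h.congr fun i => ?_
    rw [System.lightRate_eq, hq, inv_div, div_div_eq_mul_div, div_one]
    exact (one_div_mul_eq_div _ _).symm
  have hage : Tendsto (fun i => D i / lightAoI (sys i).ratio (sys i).theta) l (𝓝 1) := by
    have hr : Tendsto (fun i => (sys i).sqTime / (sys i).sqUp /
        ((sys i).meanTime / (sys i).meanUp)) l (𝓝 1) := by
      have h := hsq.div hmean one_ne_zero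
      rw [div_one] at h
      exact h
    have hpart : Tendsto (fun i => |(sys i).meanTime / (sys i).meanUp - 1| +
        |(sys i).sqTime / (sys i).sqUp / ((sys i).meanTime / (sys i).meanUp) - 1|) l (𝓝 0) := by
      simpa using (hmean.sub_const 1).abs.add (hr.sub_const 1).abs
    -- With u and w the correction factors of the two summands A and B, the relative error is
    -- (A(u-1) + B(w-1))/(A + B + 1/2). Its weights are at most 1, so no control of A and B is
    -- needed.
    rw [← tendsto_sub_nhds_zero_iff]
    refine squeeze_zero_norm' ?_ hpart
    filter_upwards [hsmall] with i hi
    have hE := System.meanTime_pos hi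
    have hMi := hM i
    have hQi := hQ i
    set A := (sys i).meanUp with hA
    set B := (sys i).sqUp / (2 * A) with hB
    have hBpos : 0 < B := by positivity
    have hL : lightAoI (sys i).ratio (sys i).theta = A + B + 1 / 2 := (sys i).lightAoI_eq
    have hLpos : 0 < A + B + 1 / 2 := by positivity
    set u := (sys i).meanTime / A with hu
    set w := (sys i).sqTime / (sys i).sqUp / u with hw
    have hDi : D i = A * u + B * w + 1 / 2 := by
      rw [hD, hw, hu, hB]
      field_simp
    have e : D i / lightAoI (sys i).ratio (sys i).theta - 1 =
        (A * (u - 1) + B * (w - 1)) / (A + B + 1 / 2) := by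
      rw [hL, hDi]
      field_simp
      ring
    rw [e, Real.norm_eq_abs, abs_div, abs_of_pos hLpos, div_le_iff₀ hLpos]
    calc |A * (u - 1) + B * (w - 1)| ≤ A * |u - 1| + B * |w - 1| := by
          refine (abs_add_le _ _).trans ?_
          rw [abs_mul, abs_mul, abs_of_pos hMi, abs_of_pos hBpos]
      _ ≤ (|u - 1| + |w - 1|) * (A + B + 1 / 2) := by
          nlinarith [abs_nonneg (u - 1), abs_nonneg (w - 1)]
  refine ⟨D, q, ?_, fun a θ hfix => ⟨?_, ?_⟩, hage, hrate⟩
  · exact hsmall.mono fun i hi => ⟨System.hasAverageAoI hi, System.hasUplinkRate hi⟩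
  -- For fixed parameters the denominator of the relative statement is a positive constant, which
  -- can be multiplied out.
  · have h := hage.mul_const (lightAoI a θ)
    rw [one_mul] at h
    refine h.congr fun i => ?_
    have hpos : 0 < lightAoI (sys i).ratio (sys i).theta := by
      have := hM i
      have := hQ i
      rw [System.lightAoI_eq]
      positivity
    rw [← (hfix i).1, ← (hfix i).2]
    exact div_mul_cancel₀ _ hpos.ne'
  · have h := hrate.mul_const (lightRate a θ)
    rw [one_mul] at h
    refine h.congr fun i => ?_
    have hpos : 0 < lightRate (sys i).ratio (sys i).theta := by
      have := hM i
      rw [System.lightRate_eq]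
      positivity
    rw [← (hfix i).1, ← (hfix i).2]
    exact div_mul_cancel₀ _ hpos.ne'
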